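/- **Setting.** A Boolean relation of arity $r$ is a set $R\subseteq\{0,1\}^r$. It is *OR-conj* (respectively *NAND-conj*) if it is the set of satisfying assignments of a formula in variables $x_1,\dots,x_r$ that is a conjunction of pins ($x_i=0$ or $x_i=1$) and of clauses $\mathrm{OR}(x_{i_1},\dots,x_{i_s})$ (respectively $\mathrm{NAND}(x_{i_1},\dots,x_{i_s})$) with $s\ge 1$ arguments. Such a formula is *normalized* if no pinned variable appears in a clause, the arguments of each clause are distinct, each clause has at least two arguments, and the arguments of no clause are a subset of those of another clause. The *width* of a formula is the greatest number of arguments of a clause (and $0$ if there are no clauses). An instance of $\#\mathrm{CSP}_d(\Gamma)$ is a finite set $V$ of variables with a set of constraints $S(v_1,\dots,v_s)$, where $S\in\Gamma$ has arity $s$ and $v_1,\dots,v_s\in V$ need not be distinct, such that every variable appears at most $d$ times (with multiplicity) in the constraints; the output is the number of satisfying assignments $V\to\{0,1\}$. Let $\Gamma_{\mathrm{pin}}=\{R_{\mathrm{zero}},R_{\mathrm{one}}\}$ with $R_{\mathrm{zero}}=\{0\}$ and $R_{\mathrm{one}}=\{1\}$. An instance of $\#w\text{-}\mathrm{HIS}_{d}$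 is a finite hypergraph $H=(V,E)$, $E$ a set of non-empty subsets of $V$, in which the greatest size of a hyper-edge is $w$ ($w=0$ if $E=\emptyset$) and every vertex lies in at most $d$ hyper-edges; the output is the number of independent sets, i.e. of sets $S\subseteq V$ that contain no hyper-edge. A *randomized approximation scheme* (RAS) for a counting problem $f$ takes an instance $x$ and an $\varepsilon\in(0,1)$ and outputs a random integer $Y$ with $\Pr(e^{-\varepsilon}f(x)\le Y\le e^{\varepsilon}f(x))\ge\frac34$. An *AP-reduction* from $f$ to $g$ is a probabilistic oracle Turing machine $M$ with input $(x,\varepsilon)$ such that (i) every oracle call of $M$ is of the form $(y,\delta)$ with $y$ an instance of $g$ and $0<\delta<1$, $\delta^{-1}\le\mathrm{poly}(|x|,\varepsilon^{-1})$; (ii) $M$ is a RAS for $f$ whenever the oracle is a RAS for $g$; (iii) the running time of $M$ is polynomial in $|x|$ and $\varepsilon^{-1}$. Write $f\le_{\mathrm{AP}}g$ if one exists. **Proposition.** Let $R$ be an OR-conj (respectively NAND-conj) relation and let $d\ge 2$. Then $R$ is defined by a normalized formula of the same kind, and for every such formula $\varphi$, $$\#\mathrm{CSP}_d(\{R\}\cup\Gamma_{\mathrm{pin}})\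 \le_{\mathrm{AP}}\ \#w\text{-}\mathrm{HIS}_{kd},$$ where $w$ is the width of $\varphi$ and $k$ is the greatest number of times that any variable appears in $\varphi$ (in pins and clauses together). -/

import Mathlib

noncomputable section

namespace BoundedCSP

/-! ### Boolean relations, OR-conj and NAND-conj -/

/-- A Boolean relation of some arity. -/
structure BoolRel where
  arity : ℕ
  tuples : Set (Fin arity → Bool)

/-- The two kinds of clause: disjunctions `OR` and negated conjunctions `NAND`. -/
inductive Connective
  | or
  | nand

/-- The assignment `a` satisfies the clause with connective `g` and the given arguments. -/
def Connective.Holds {r : ℕ} (g : Connective) (a : Fin r → Bool) (args : Multiset (Fin r)) : Prop :=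
  match g with
  | .or => ∃ i ∈ args, a i = true
  | .nand => ¬ ∀ i ∈ args, a i = true

/-- A conjunction of pins `x = c`, written `(x, c)`, and of clauses in the variables
`x_0, …, x_{r-1}`.  A clause is given by the multiset of its arguments (a variable may be
repeated, and there is at least one argument); whether it is an `OR` or a `NAND` is decided by the
connective with which the formula is read. -/
structure ConjFormula (r : ℕ) where
  pins : Finset (Fin r × Bool)
  clauses : Finset (Multiset (Fin r))
  clause_ne_zero : ∀ c ∈ clauses, c ≠ 0

namespace ConjFormula

variable {r : ℕ}

/-- `φ`, read with connective `g`, defines the set `R` of tuples. -/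
def Defines (φ : ConjFormula r) (g : Connective) (R : Set (Fin r → Bool)) : Prop :=
  ∀ a : Fin r → Bool,
    a ∈ R ↔ (∀ p ∈ φ.pins, a p.1 = p.2) ∧ ∀ c ∈ φ.clauses, g.Holds a c

structure IsNormalized (φ : ConjFormula r) : Prop where
  /-- No pinned variable appears in a clause. -/
  pin_notMem : ∀ p ∈ φ.pins, ∀ c ∈ φ.clauses, p.1 ∉ c
  /-- The arguments of each clause are distinct. -/
  nodup : ∀ c ∈ φ.clauses, c.Nodup
  /-- Every clause has at least two arguments. -/
  two_le_card : ∀ c ∈ φ.clauses, 2 ≤ c.card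
  /-- The arguments of no clause are a subset of those of another one. -/
  not_subset : ∀ c ∈ φ.clauses, ∀ c' ∈ φ.clauses, c ≠ c' → ¬ c ⊆ c'

/-- The greatest number of arguments of a clause (`0` if there are no clauses). -/
def width (φ : ConjFormula r) : ℕ := φ.clauses.sup Multiset.card

/-- The number of times that the variable `x` appears in `φ`, in pins and in clauses. -/
def occurrences (φ : ConjFormula r) (x : Fin r) : ℕ :=
  (φ.pins.filter fun p => p.1 = x).card + ∑ c ∈ φ.clauses, c.count x

/-- The greatest number of times that any variable appears in `φ`. -/
def maxOccurrences (φ : ConjFormula r) : ℕ := Finset.univ.sup φ.occurrences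

end ConjFormula

/-- `R` is an OR-conj relation (for `g = .or`) or a NAND-conj relation (for `g = .nand`). -/
def BoolRel.IsConj (g : Connective) (R : BoolRel) : Prop :=
  ∃ φ : ConjFormula R.arity, φ.Defines g R.tuples

/-! ### Counting problems and codes -/

/-- A counting problem: its instances, the strings that represent an instance, and the number to
be computed. -/
structure CountingProblem where
  Instance : Type
  IsCode : List Bool → Instance → Prop
  count : Instance → ℕ

/-- The list `a, b, c, …` is written as the string `1^a 0 1^b 0 1^c 0 …`. -/
def encodeNats (l : List ℕ) : List Bool :=
  l.flatMap fun a => List.replicate a true ++ [false]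

/-! ### Bounded-degree counting constraint satisfaction -/

/-- A constraint language; the name of a relation is its position in the list. -/
abbrev ConstraintLanguage := List BoolRel

/-- The language `{R_zero, R_one}` with `R_zero = {0}` and `R_one = {1}`. -/
def pinLanguage : ConstraintLanguage :=
  [⟨1, {fun _ => false}⟩, ⟨1, {fun _ => true}⟩]

/-- A constraint over `Γ` with variables in `V`: the name of a relation of `Γ` and a scope, whose
entries need not be distinct. -/
abbrev Constraint (Γ : ConstraintLanguage) (V : Type) : Type :=
  Σ i : Fin Γ.length, (Fin (Γ.get i).arity → V)

/-- An instance: a finite set of variables, named `0, …, numVars - 1`, and a set of constraints. -/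
structure CSPInstance (Γ : ConstraintLanguage) where
  numVars : ℕ
  constraints : Finset (Constraint Γ (Fin numVars))

namespace CSPInstance

variable {Γ : ConstraintLanguage}

def Satisfies (I : CSPInstance Γ) (s : Fin I.numVars → Bool) : Prop :=
  ∀ c ∈ I.constraints, (fun j => s (c.2 j)) ∈ (Γ.get c.1).tuples

/-- `Z(I)`, the number of satisfying assignments. -/
def Z (I : CSPInstance Γ) : ℕ := Set.ncard {s | I.Satisfies s}

/-- The number of times that `v` appears among the constraints. -/
def occurrences (I : CSPInstance Γ) (v : Fin I.numVars) : ℕ :=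
  ∑ c ∈ I.constraints, (Finset.univ.filter fun j => c.2 j = v).card

def degree (I : CSPInstance Γ) : ℕ := Finset.univ.sup I.occurrences

/-- `s` is the number of variables followed by a list of the constraints, in any order and
possibly with repetitions; a constraint is written as its name followed by its scope. -/
def IsCode (s : List Bool) (I : CSPInstance Γ) : Prop :=
  ∃ L : List (Constraint Γ (Fin I.numVars)),
    (∀ c, c ∈ L ↔ c ∈ I.constraints) ∧
    s = encodeNats (I.numVars ::
      L.flatMap fun c => (c.1 : ℕ) :: List.ofFn fun j => (c.2 j : ℕ))

end CSPInstance

/-- `#CSP_d(Γ)`. -/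
def countCSP (d : ℕ) (Γ : ConstraintLanguage) : CountingProblem where
  Instance := {I : CSPInstance Γ // I.degree ≤ d}
  IsCode s I := I.1.IsCode s
  count I := I.1.Z

/-! ### Counting independent sets in hypergraphs -/

/-- A finite hypergraph with vertices `0, …, numVertices - 1` and non-empty hyper-edges. -/
structure FinHypergraph where
  numVertices : ℕ
  graph : Hypergraph (Fin numVertices)
  vertexSet_eq : graph.vertexSet = Set.univ
  edge_nonempty : ∀ e ∈ graph.edgeSet, e.Nonempty

namespace FinHypergraph

/-- The number of hyper-edges that contain `v`. -/
def vertexDegree (H : FinHypergraph) (v : Fin H.numVertices) : ℕ :=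
  Set.ncard {e | e ∈ H.graph.edgeSet ∧ v ∈ e}

def degree (H : FinHypergraph) : ℕ := Finset.univ.sup H.vertexDegree

/-- The greatest size of a hyper-edge (`0` if there are none). -/
def width (H : FinHypergraph) : ℕ := sSup (Set.ncard '' H.graph.edgeSet)

def IsIndependent (H : FinHypergraph) (S : Set (Fin H.numVertices)) : Prop :=
  ∀ e ∈ H.graph.edgeSet, ¬ e ⊆ S

def numIndependent (H : FinHypergraph) : ℕ := Set.ncard {S | H.IsIndependent S}

/-- `s` is the number of vertices followed by a list of the hyper-edges, in any order and possibly
with repetitions; a hyper-edge is written as the length of a list of its vertices followed by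
that list. -/
def IsCode (s : List Bool) (H : FinHypergraph) : Prop :=
  ∃ L : List (List (Fin H.numVertices)),
    (∀ e, e ∈ H.graph.edgeSet ↔ ∃ l ∈ L, e = {v | v ∈ l}) ∧
    s = encodeNats (H.numVertices ::
      L.flatMap fun l => l.length :: l.map fun v => (v : ℕ))

end FinHypergraph

/-- `#w-HIS_d`: counting independent sets in hypergraphs of width `w` and degree at most `d`. -/
def countHIS (w d : ℕ) : CountingProblem where
  Instance := {H : FinHypergraph // H.width = w ∧ H.degree ≤ d}
  IsCode s H := H.1.IsCode s
  count H := H.1.numIndependent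

/-! ### Randomized approximation schemes -/

/-- The number in `[0, 1)` with the binary expansion `0.b₁b₂b₃…`.  Error bounds are
given to machines in this form. -/
def errorValue : List Bool → ℝ
  | [] => 0
  | b :: l => ((if b then 1 else 0) + errorValue l) / 2

/-- `e` represents an error bound in `(0, 1)`. -/
def IsErrorBound (e : List Bool) : Prop := 0 < errorValue e ∧ errorValue e < 1

/-- The natural number with the given binary digits, the least significant one first. -/
def outputValue : List Bool → ℕ
  | [] => 0
  | b :: l => (if b then 1 else 0) + 2 * outputValue l

/-- The strings that represent a number `Y` with `e^{-ε} z ≤ Y ≤ e^ε z`. -/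
def goodOutputs (ε : ℝ) (z : ℕ) : Set (List Bool) :=
  {y | Real.exp (-ε) * z ≤ outputValue y ∧ (outputValue y : ℝ) ≤ Real.exp ε * z}

/-- A random output `O s e` for each input string `s` and error bound `e`. -/
abbrev RandomOracle := List Bool → List Bool → PMF (List Bool)

/-- `O` has the input-output behaviour of a randomized approximation scheme for `g`. -/
def RandomOracle.IsRAS (O : RandomOracle) (g : CountingProblem) : Prop :=
  ∀ (s : List Bool) (y : g.Instance), g.IsCode s y → ∀ e : List Bool, IsErrorBound e →
    3 / 4 ≤ (O s e).toOuterMeasure (goodOutputs (errorValue e) (g.count y))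

/-! ### Probabilistic oracle Turing machines -/

/-- What happens when a label is reached, before its statement is executed. -/
inductive LabelKind
  | ordinary
  | toss
  | query

/-- A probabilistic oracle Turing machine: a multi-stack Turing machine in the sense of
`Turing.TM2`, with finitely many binary stacks, labels and internal states, some of whose labels
toss a fair coin or query the oracle.  Calls to the oracle follow the conventions of the
machine itself: two arguments on the stacks `inst` and `err`, and the result on `inst`. -/
structure OracleTM where
  /-- The stacks. -/
  K : Type
  [decEqK : DecidableEq K]
  [fintypeK : Fintype K]
  /-- The stack for the input string, and later for queries, answers and the output. -/
  inst : K
  /-- The stack for the error bound of the input, and later for those of the queries. -/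
  err : K
  inst_ne_err : inst ≠ err
  /-- The labels. -/
  Λ : Type
  [fintypeΛ : Fintype Λ]
  start : Λ
  kind : Λ → LabelKind
  /-- The internal states. -/
  σ : Type
  [fintypeσ : Fintype σ]
  init : σ
  /-- How the result of a coin toss changes the internal state. -/
  toss : Bool → σ → σ
  program : Λ → Turing.TM2.Stmt (fun _ : K => Bool) Λ σ

namespace OracleTM

attribute [instance] decEqK fintypeK fintypeΛ fintypeσ

variable (M : OracleTM)

abbrev Cfg : Type := Turing.TM2.Cfg (fun _ : M.K => Bool) M.Λ M.σ

/-- The input string and the error bound are on the stacks `inst` and `err`. -/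
def initial (s e : List Bool) : M.Cfg where
  l := some M.start
  var := M.init
  stk := Function.update (Function.update (fun _ => []) M.err e) M.inst s

/-- One step.  At a label of kind `toss` the statement is executed after a fair coin has changed
the internal state, at a label of kind `query` after the query on the stack `inst` has been
replaced by the answer of the oracle to it, with error bound as on the stack `err`.
The label `none` is the halting state. -/
def step (O : RandomOracle) (c : M.Cfg) : PMF M.Cfg :=
  match c.l with
  | none => PMF.pure c
  | some ℓ =>
    match M.kind ℓ with
    | .ordinary => PMF.pure (Turing.TM2.stepAux (M.program ℓ) c.var c.stk)
    | .toss => (PMF.uniformOfFintype Bool).map fun b =>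
        Turing.TM2.stepAux (M.program ℓ) (M.toss b c.var) c.stk
    | .query => (O (c.stk M.inst) (c.stk M.err)).map fun a =>
        Turing.TM2.stepAux (M.program ℓ) c.var (Function.update c.stk M.inst a)

/-- The distribution of the configuration after `t` steps from `c`. -/
def run (O : RandomOracle) : ℕ → M.Cfg → PMF M.Cfg
  | 0, c => PMF.pure c
  | t + 1, c => (M.step O c).bind (run O t)

/-- With oracle `O`, the configuration `c` can occur on input `(s, e)` after `t` steps. -/
def CanReach (O : RandomOracle) (s e : List Bool) (t : ℕ) (c : M.Cfg) : Prop :=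
  c ∈ (M.run O t (M.initial s e)).support

/-- The machine makes an oracle call in the configuration `c`. -/
def IsQuery (c : M.Cfg) : Prop := ∃ ℓ, c.l = some ℓ ∧ M.kind ℓ = .query

/-- Every computation with oracle `O` on input `(s, e)` halts within `t` steps. -/
def HaltsWithin (O : RandomOracle) (s e : List Bool) (t : ℕ) : Prop :=
  ∀ c, M.CanReach O s e t c → c.l = none

/-- The distribution of the contents of the output stack after `t` steps. -/
def outputDist (O : RandomOracle) (s e : List Bool) (t : ℕ) : PMF (List Bool) :=
  (M.run O t (M.initial s e)).map fun c => c.stk M.inst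

/-- `M` is an approximation-preserving reduction from `f` to `g`. -/
structure IsAPReduction (f g : CountingProblem) : Prop where
  /-- Every oracle call is an instance of `g` together with an error bound `δ` in `(0, 1)` such
  that `δ⁻¹` is at most polynomial in `|x|` and `ε⁻¹`. -/
  queries : ∃ p : MvPolynomial (Fin 2) ℝ,
    ∀ (s : List Bool) (x : f.Instance), f.IsCode s x → ∀ e : List Bool, IsErrorBound e →
      ∀ (O : RandomOracle) (t : ℕ) (c : M.Cfg), M.CanReach O s e t c → M.IsQuery c →
        (∃ y : g.Instance, g.IsCode (c.stk M.inst) y) ∧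
        IsErrorBound (c.stk M.err) ∧
        (errorValue (c.stk M.err))⁻¹ ≤ p.eval ![(s.length : ℝ), (errorValue e)⁻¹]
  /-- If the oracle is a randomized approximation scheme for `g`, then `M` halts with an output
  that makes it one for `f`. -/
  correct : ∀ O : RandomOracle, O.IsRAS g →
    ∀ (s : List Bool) (x : f.Instance), f.IsCode s x → ∀ e : List Bool, IsErrorBound e →
      ∃ t : ℕ, M.HaltsWithin O s e t ∧
        3 / 4 ≤ (M.outputDist O s e t).toOuterMeasure (goodOutputs (errorValue e) (f.count x))
  /-- The number of steps is at most polynomial in `|x|` and `ε⁻¹`. -/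
  polyTime : ∃ p : MvPolynomial (Fin 2) ℝ,
    ∀ (s : List Bool) (x : f.Instance), f.IsCode s x → ∀ e : List Bool, IsErrorBound e →
      ∀ O : RandomOracle, ∃ t : ℕ,
        (t : ℝ) ≤ p.eval ![(s.length : ℝ), (errorValue e)⁻¹] ∧ M.HaltsWithin O s e t

end OracleTM

/-- `f ≤_AP g`. -/
def APReducible (f g : CountingProblem) : Prop :=
  ∃ M : OracleTM, M.IsAPReduction f g

end BoundedCSP

end

noncomputable section

namespace BoundedCSP

open Turing

/-! ### Machine runs without coin tosses and oracle calls -/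

namespace OracleTM

variable {M : OracleTM}

/-! Let `v` be the value that is of no use to a clause: 0 for OR, 1 for NAND. A clause says that not
all of its arguments equal `v`, so apart from pins a satisfying assignment amounts to an independent
set in the hypergraph of the clauses, namely the set of variables with value `v`. A pin to the other
value is a clause with one argument. A variable that is pinned to `v` somewhere (a forced variable)
is deleted from all clauses. If some clause becomes empty, there is no satisfying assignment and the
answer is 0. Otherwise each forced variable receives a singleton hyper-edge, which keeps it out of
every independent set, and satisfying assignments correspond to independent sets (`Z_eq_ncard`).

The hypergraph must have width exactly `w` and degree at most `k * d`. Each occurrence of a variable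
in a constraint produces at most `k` hyper-edges, which bounds the degree at the variables
(`ncard_edges_le`). For the width, `w` new vertices are added, with the hyper-edge of all of them
and their singletons; they do not change the number of independent sets, and each lies in at most `2
≤ k * d` hyper-edges. If `w = 0`, all constraints are pins, and the machine computes the number
itself, a power of two or 0.

Since the count is preserved exactly, a single oracle call with the error bound of the input
suffices, and its answer is the output (`Prog.apReducible`).

To obtain an actual machine, programs `Prog` are used whose loops all run as often as the input has
letters, so that polynomial running time is automatic. `path_code` shows that the compiled machine
executes its program, `result_reduction` computes what the concrete program writes, and
`apReducible_of_clauses` identifies this with the code of the hypergraph.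

For the existence of a normalized formula, one takes all pins that `R` implies and all minimal
implied clauses with at least two arguments (`ConjFormula.canonical`). -/

/-- `M` passes from `c` to `c'` in `t` steps, all of them at ordinary labels. -/
inductive OrdinaryPath (M : OracleTM) : ℕ → M.Cfg → M.Cfg → Prop
  | refl (c : M.Cfg) : OrdinaryPath M 0 c c
  | cons {t : ℕ} {l : M.Λ} {v : M.σ} {S : M.K → List Bool} {c' : M.Cfg}
      (hl : M.kind l = .ordinary)
      (h : OrdinaryPath M t (TM2.stepAux (M.program l) v S) c') :
      OrdinaryPath M (t + 1) ⟨some l, v, S⟩ c'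

namespace OrdinaryPath

theorem trans {t u : ℕ} {a b c : M.Cfg} (h : M.OrdinaryPath t a b) (h' : M.OrdinaryPath u b c) :
    M.OrdinaryPath (t + u) a c := by
  induction h with
  | refl => simpa using h'
  | @cons t l v S c₁ hl _ ih =>
    rw [Nat.add_right_comm]
    exact .cons hl (ih h')

theorem single {l : M.Λ} {v : M.σ} {S : M.K → List Bool} (hl : M.kind l = .ordinary) :
    M.OrdinaryPath 1 ⟨some l, v, S⟩ (TM2.stepAux (M.program l) v S) :=
  .cons hl (.refl _)

theorem run_add {t : ℕ} {a b : M.Cfg} (h : M.OrdinaryPath t a b) (O : RandomOracle) (u : ℕ) :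
    M.run O (t + u) a = M.run O u b := by
  induction h with
  | refl => simp
  | @cons t l v S c₁ hl _ ih =>
    rw [Nat.add_right_comm, run, step]
    simp only [hl, PMF.pure_bind]
    exact ih

/-- The condition on oracle calls concerns every configuration reachable at any time, so the
intermediate times of a path matter and not only its end. -/
theorem run_lt {t : ℕ} {a b : M.Cfg} (h : M.OrdinaryPath t a b) (O : RandomOracle) {u : ℕ}
    (hu : u < t) : ∃ c, M.run O u a = PMF.pure c ∧ ¬ M.IsQuery c := by
  induction h generalizing u with
  | refl => simp at hu
  | @cons t l v S c₁ hl _ ih =>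
    cases u with
    | zero =>
      refine ⟨_, rfl, ?_⟩
      rintro ⟨m, hm, hq⟩
      cases hm
      simp [hl] at hq
    | succ u =>
      obtain ⟨c, hc, hn⟩ := ih (Nat.lt_of_succ_lt_succ hu)
      refine ⟨c, ?_, hn⟩
      rw [run, step]
      simp only [hl, PMF.pure_bind]
      exact hc

end OrdinaryPath

theorem run_halted (O : RandomOracle) (t : ℕ) {c : M.Cfg} (hc : c.l = none) :
    M.run O t c = PMF.pure c := by
  induction t with
  | zero => rfl
  | succ t ih =>
    rw [run, step]
    simp only [hc, PMF.pure_bind]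
    exact ih

end OracleTM

/-! ### Structured programs on stacks -/

/-- Programs over stacks of bits and a finite internal state. The body of a `loop` is executed as
often as the input string has letters. -/
inductive Prog (K σ : Type) : Type
  | push (k : K) (f : σ → Bool)
  | pop (k : K) (f : σ → Option Bool → σ)
  | load (f : σ → σ)
  | seq (p q : Prog K σ)
  | ite (f : σ → Bool) (p q : Prog K σ)
  | loop (p : Prog K σ)

namespace Prog

variable {K σ : Type}

/-- The effect of a program, where loops are executed `N` times. -/
def exec [DecidableEq K] (N : ℕ) : Prog K σ → σ × (K → List Bool) → σ × (K → List Bool)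
  | push k f, s => (s.1, Function.update s.2 k (f s.1 :: s.2 k))
  | pop k f, s => (f s.1 (s.2 k).head?, Function.update s.2 k (s.2 k).tail)
  | load f, s => (f s.1, s.2)
  | seq p q, s => exec N q (exec N p s)
  | ite f p q, s => cond (f s.1) (exec N p s) (exec N q s)
  | loop p, s => (exec N p)^[N] s

/-- A bound for the running time, where loops are executed `N` times. -/
def time (N : ℕ) : Prog K σ → ℕ
  | push _ _ => 1
  | pop _ _ => 1
  | load _ => 1
  | seq p q => time N p + time N q
  | ite _ p q => 1 + time N p + time N q
  -- `N` successful tests, each followed by the body, then one failing test, then `N` letters wound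
  -- back and one failing test there.
  | loop p => N * (1 + time N p) + 1 + (N + 1)

/-- A loop multiplies the time of its body by essentially the input length, and the nesting depth is
fixed by the program. -/
theorem exists_time_eq_eval (p : Prog K σ) :
    ∃ P : Polynomial ℕ, ∀ N, p.time N = P.eval N := by
  induction p with
  | push | pop | load => exact ⟨1, fun N => by simp [time]⟩
  | seq p q hp hq =>
    obtain ⟨P, hP⟩ := hp
    obtain ⟨Q, hQ⟩ := hq
    exact ⟨P + Q, fun N => by simp [time, hP, hQ]⟩
  | ite f p q hp hq =>
    obtain ⟨P, hP⟩ := hp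
    obtain ⟨Q, hQ⟩ := hq
    exact ⟨1 + P + Q, fun N => by simp [time, hP, hQ]⟩
  | loop p hp =>
    obtain ⟨P, hP⟩ := hp
    exact ⟨.X * (1 + P) + 1 + (.X + 1), fun N => by simp [time, hP]⟩

/-- The loops of a program. -/
def Node : Prog K σ → Type
  | push _ _ => Empty
  | pop _ _ => Empty
  | load _ => Empty
  | seq p q => Node p ⊕ Node q
  | ite _ p q => Node p ⊕ Node q
  | loop p => Option (Node p)

/-- The machine labels that are needed for a program. -/
def Label : Prog K σ → Type
  | push _ _ => Unit
  | pop _ _ => Unit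
  | load _ => Unit
  | seq p q => Label p ⊕ Label q
  | ite _ p q => Option (Label p ⊕ Label q)
  | loop p => Bool ⊕ Label p

instance (p : Prog K σ) : Finite p.Node := by
  induction p with
  | push | pop | load => exact inferInstanceAs (Finite Empty)
  | seq p q => exact inferInstanceAs (Finite (Node p ⊕ Node q))
  | ite f p q => exact inferInstanceAs (Finite (Node p ⊕ Node q))
  | loop p => exact inferInstanceAs (Finite (Option (Node p)))

instance (p : Prog K σ) : Finite p.Label := by
  induction p with
  | push | pop | load => exact inferInstanceAs (Finite Unit)
  | seq p q => exact inferInstanceAs (Finite (Label p ⊕ Label q))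
  | ite f p q => exact inferInstanceAs (Finite (Option (Label p ⊕ Label q)))
  | loop p => exact inferInstanceAs (Finite (Bool ⊕ Label p))

def entry : (p : Prog K σ) → p.Label
  | push _ _ => ()
  | pop _ _ => ()
  | load _ => ()
  | seq p _ => Sum.inl (entry p)
  | ite _ _ _ => none
  | loop _ => Sum.inl false

/-- The stacks of a machine that executes a program: those of the program, one for the error bound,
and for each loop one stack for the iterations left and one for those already made. -/
inductive MachineStack (K ν : Type) : Type
  | user (k : K)
  | err
  | clock (n : ν)
  | spent (n : ν)

instance {ν : Type} [Finite K] [Finite ν] : Finite (MachineStack K ν) :=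
  Finite.of_injective
    (fun k : MachineStack K ν => match k with
      | .user k => (Sum.inl k : K ⊕ Option (ν ⊕ ν))
      | .err => Sum.inr none
      | .clock n => Sum.inr (some (Sum.inl n))
      | .spent n => Sum.inr (some (Sum.inr n)))
    (by rintro (_ | _ | _ | _) (_ | _ | _ | _) h <;> simp_all)

instance {ν : Type} : DecidableEq (MachineStack K ν) := Classical.decEq _

/-- The contents of the machine stacks. -/
def contents {ν : Type} (S : K → List Bool) (e : List Bool) (c a : ν → ℕ) :
    MachineStack K ν → List Bool
  | .user k => S k
  | .err => e
  | .clock n => List.replicate (c n) true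
  | .spent n => List.replicate (a n) true

section contents

variable {ν : Type} (S : K → List Bool) (e : List Bool) (c a : ν → ℕ)

theorem update_contents_user [DecidableEq K] (k : K) (l : List Bool) :
    Function.update (contents S e c a) (.user k) l = contents (Function.update S k l) e c a := by
  funext j
  rcases j with j | _ | j | j
  · by_cases h : j = k <;> simp [contents, Function.update, h]
  all_goals simp [contents, Function.update]

theorem update_contents_clock [DecidableEq ν] (n : ν) (m : ℕ) :
    Function.update (contents S e c a) (.clock n) (List.replicate m true) =
      contents S e (Function.update c n m) a := by
  funext j
  rcases j with j | _ | j | j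
  case clock => by_cases h : j = n <;> simp [contents, Function.update, h]
  all_goals simp [contents, Function.update]

theorem update_contents_spent [DecidableEq ν] (n : ν) (m : ℕ) :
    Function.update (contents S e c a) (.spent n) (List.replicate m true) =
      contents S e c (Function.update a n m) := by
  funext j
  rcases j with j | _ | j | j
  case spent => by_cases h : j = n <;> simp [contents, Function.update, h]
  all_goals simp [contents, Function.update]

end contents

/-- Start another iteration if the clock has not run down. -/
def loopTest {ν Λ : Type} (n : ν) (body done : Λ) :
    TM2.Stmt (fun _ : MachineStack K ν => Bool) Λ (σ × Option Bool) :=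
  .pop (.clock n) (fun v b => (v.1, b))
    (.branch (fun v => v.2.isSome) (.push (.spent n) (fun _ => true) (.goto fun _ => body))
      (.goto fun _ => done))

/-- Wind up the clock again. -/
def loopRestore {ν Λ : Type} (n : ν) (again exit : Λ) :
    TM2.Stmt (fun _ : MachineStack K ν => Bool) Λ (σ × Option Bool) :=
  .pop (.spent n) (fun v b => (v.1, b))
    (.branch (fun v => v.2.isSome) (.push (.clock n) (fun _ => true) (.goto fun _ => again))
      (.goto fun _ => exit))

section loop

variable {ν Λ : Type} [DecidableEq ν] (n : ν) (l l' : Λ) (v : σ × Option Bool)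
  (S : K → List Bool) (e : List Bool) (c a : ν → ℕ)

theorem stepAux_loopTest_succ (m : ℕ) :
    TM2.stepAux (loopTest n l l') v (contents S e (Function.update c n (m + 1)) a) =
      ⟨some l, (v.1, some true),
        contents S e (Function.update c n m) (Function.update a n (a n + 1))⟩ := by
  simp [loopTest, contents, List.replicate_succ, update_contents_clock, ← update_contents_spent]

theorem stepAux_loopTest_zero :
    TM2.stepAux (loopTest n l l') v (contents S e (Function.update c n 0) a) =
      ⟨some l', (v.1, none), contents S e (Function.update c n 0) a⟩ := by
  have := update_contents_clock S e (Function.update c n 0) a n 0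
  simp only [List.replicate_zero, Function.update_idem] at this
  simp [loopTest, contents, this]

theorem stepAux_loopRestore_succ (m : ℕ) :
    TM2.stepAux (loopRestore n l l') v (contents S e c (Function.update a n (m + 1))) =
      ⟨some l, (v.1, some true),
        contents S e (Function.update c n (c n + 1)) (Function.update a n m)⟩ := by
  simp [loopRestore, contents, List.replicate_succ, update_contents_spent,
    ← update_contents_clock]

theorem stepAux_loopRestore_zero :
    TM2.stepAux (loopRestore n l l') v (contents S e c (Function.update a n 0)) =
      ⟨some l', (v.1, none), contents S e c (Function.update a n 0)⟩ := by
  have := update_contents_spent S e c (Function.update a n 0) n 0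
  simp only [List.replicate_zero, Function.update_idem] at this
  simp [loopRestore, contents, this]

end loop

/-- The statements for a program, which ends at the label `exit`. -/
def code {ν Λ : Type} : (p : Prog K σ) → (p.Node → ν) → (p.Label → Λ) → Λ → p.Label →
    TM2.Stmt (fun _ : MachineStack K ν => Bool) Λ (σ × Option Bool)
  | push k f, _, _, exit, _ => .push (.user k) (fun v => f v.1) (.goto fun _ => exit)
  | pop k f, _, _, exit, _ => .pop (.user k) (fun v b => (f v.1 b, v.2)) (.goto fun _ => exit)
  | load f, _, _, exit, _ => .load (fun v => (f v.1, v.2)) (.goto fun _ => exit)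
  | seq p q, node, label, exit, l => match l with
    | .inl l => code p (node ∘ Sum.inl) (label ∘ Sum.inl) (label (.inr (entry q))) l
    | .inr l => code q (node ∘ Sum.inr) (label ∘ Sum.inr) exit l
  | ite f p q, node, label, exit, l => match l with
    | none => .branch (fun v => f v.1) (.goto fun _ => label (some (.inl (entry p))))
        (.goto fun _ => label (some (.inr (entry q))))
    | some (.inl l) => code p (node ∘ Sum.inl) (fun l => label (some (.inl l))) exit l
    | some (.inr l) => code q (node ∘ Sum.inr) (fun l => label (some (.inr l))) exit l
  | loop p, node, label, exit, l => match l with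
    -- The label `false` is the test and `true` the restoring phase. The clock is restored so that
    -- an enclosing loop can run this loop again.
    | .inl false => loopTest (node none) (label (.inr (entry p))) (label (.inl true))
    | .inl true => loopRestore (node none) (label (.inl true)) exit
    | .inr l => code p (node ∘ some) (label ∘ .inr) (label (.inl false)) l

end Prog

end BoundedCSP

end

/-! ### Compilation of structured programs into oracle machines -/

noncomputable section

namespace BoundedCSP

open Turing

namespace Prog

variable {K σ : Type}

inductive Phase
  | setup
  | finish
  | ask

instance : Finite Phase :=
  Finite.of_injective (fun p : Phase => match p with
    | .setup => (0 : Fin 3)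
    | .finish => 1
    | .ask => 2) (by rintro (_ | _ | _) (_ | _ | _) h <;> simp_all)

/-- Push a letter on each of the given clocks. -/
def pushClocks {ν Λ σ : Type} (l : List ν)
    (q : TM2.Stmt (fun _ : MachineStack K ν => Bool) Λ σ) :
    TM2.Stmt (fun _ : MachineStack K ν => Bool) Λ σ :=
  l.foldr (fun n q => .push (.clock n) (fun _ => true) q) q

theorem stepAux_pushClocks {ν Λ σ : Type} [DecidableEq ν] (l : List ν)
    (q : TM2.Stmt (fun _ : MachineStack K ν => Bool) Λ σ) (v : σ)
    (S : K → List Bool) (e : List Bool) (c a : ν → ℕ) :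
    TM2.stepAux (pushClocks l q) v (contents S e c a) =
      TM2.stepAux q v (contents S e (fun n => c n + l.count n) a) := by
  induction l generalizing c with
  | nil => simp [pushClocks]
  | cons n l ih =>
    rw [pushClocks, List.foldr_cons, TM2.stepAux]
    have : true :: contents S e c a (.clock n) = List.replicate (c n + 1) true := rfl
    rw [this, update_contents_clock]
    refine (ih _).trans ?_
    congr 2
    funext m
    by_cases h : n = m
    · subst h; simp; omega
    · simp [h, Function.update_of_ne (Ne.symm h)]

/-- Move a letter of the input, and push a letter on each of the given clocks. -/
def setupStmt {ν Λ : Type} (inp out : K) (l : List ν) (again exit : Λ) :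
    TM2.Stmt (fun _ : MachineStack K ν => Bool) Λ (σ × Option Bool) :=
  .pop (.user out) (fun v b => (v.1, b))
    (.branch (fun v => v.2.isSome)
      (.push (.user inp) (fun v => v.2.getD false) (pushClocks l (.goto fun _ => again)))
      (.goto fun _ => exit))

section setup

variable {ν Λ : Type} [DecidableEq ν] [DecidableEq K] {inp out : K} (l : List ν)
  (again exit : Λ) (v : σ × Option Bool) (s : List Bool) (e : List Bool) (c a : ν → ℕ)

omit [DecidableEq ν] in
theorem stepAux_setupStmt_nil (hio : inp ≠ out) :
    TM2.stepAux (setupStmt inp out l again exit) v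
      (contents (Function.update (Function.update (fun _ => []) out []) inp s) e c a) =
      ⟨some exit, (v.1, none), contents (Function.update (fun _ => []) inp s) e c a⟩ := by
  have e₂ : Function.update (Function.update (fun _ => []) inp s) out [] =
      (Function.update (fun _ => []) inp s : K → List Bool) :=
    Function.update_eq_self_iff.2 (by simp [Function.update_of_ne hio.symm])
  simp [setupStmt, contents, Function.update_of_ne hio.symm, update_contents_user, e₂]

theorem stepAux_setupStmt_cons (hio : inp ≠ out) (x : Bool) (r : List Bool) :
    TM2.stepAux (setupStmt inp out l again exit) v
      (contents (Function.update (Function.update (fun _ => []) out (x :: s)) inp r) e c a) =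
      ⟨some again, (v.1, some x),
        contents (Function.update (Function.update (fun _ => []) out s) inp (x :: r)) e
          (fun n => c n + l.count n) a⟩ := by
  have e₁ : Function.update (Function.update (Function.update (Function.update (fun _ => []) out
        (x :: s)) inp r) out s) inp (x :: r) =
      (Function.update (Function.update (fun _ => []) out s) inp (x :: r) : K → List Bool) := by
    rw [Function.update_comm hio, Function.update_idem, Function.update_idem]
  simp [setupStmt, contents, Function.update_of_ne hio.symm, update_contents_user,
          Function.update_of_ne hio, stepAux_pushClocks, e₁]

end setup

variable [Fintype K] [Fintype σ]

/-- The machine that moves its input from the stack `out` to the stack `inp` (in reverse order),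
executes `p` with as many iterations of each loop as the input has letters, and finally, if the
internal state satisfies `ask`, replaces the string on `out` by the answer of the oracle to it. -/
def machine (p : Prog K σ) (inp out : K) (start : σ) (ask : σ → Bool) : OracleTM where
  K := MachineStack K p.Node
  decEqK := inferInstance
  fintypeK := Fintype.ofFinite _
  inst := .user out
  err := .err
  inst_ne_err := by simp
  Λ := Phase ⊕ p.Label
  fintypeΛ := Fintype.ofFinite _
  start := .inl .setup
  kind l := match l with
    | .inl .ask => .query
    | _ => .ordinary
  σ := σ × Option Bool
  fintypeσ := inferInstance
  init := (start, none)
  toss _ v := v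
  program l := match l with
    | .inl .setup => setupStmt inp out (letI := Fintype.ofFinite p.Node; Finset.univ.toList)
        (.inl .setup) (.inr p.entry)
    | .inl .finish => .branch (fun v => ask v.1) (.goto fun _ => .inl .ask) .halt
    | .inl .ask => .halt
    | .inr l => code p id .inr (.inl .finish) l

variable [DecidableEq K] {p : Prog K σ} {inp out : K} {start : σ} {ask : σ → Bool}

/-- `C n x c` means that `c` represents the datum `x` with `n` rounds left. A relation is used
instead of a function because part of the internal state, the letter popped last, is not tracked. -/
theorem path_iterate {M : OracleTM} {α : Type} {C : ℕ → α → M.Cfg → Prop} {T : ℕ} {f : α → α}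
    (h : ∀ n x c, C (n + 1) x c → ∃ t ≤ T, ∃ c', M.OrdinaryPath t c c' ∧ C n (f x) c')
    (n : ℕ) (x : α) (c : M.Cfg) (hc : C n x c) :
    ∃ t ≤ n * T, ∃ c', M.OrdinaryPath t c c' ∧ C 0 (f^[n] x) c' := by
  induction n generalizing x c with
  | zero => exact ⟨0, by simp, c, .refl _, hc⟩
  | succ n ih =>
    obtain ⟨t, ht, c₁, hp, hc₁⟩ := h n x c hc
    obtain ⟨u, hu, c₂, hp₂, hc₂⟩ := ih _ _ hc₁
    exact ⟨t + u, by rw [Nat.succ_mul]; omega, c₂, hp.trans hp₂, hc₂⟩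

omit [DecidableEq K] in
/-- A step of the machine, computed for the concrete types of labels, states and stacks. -/
theorem path_single {l : Phase ⊕ p.Label} (hl : (machine p inp out start ask).kind l = .ordinary)
    {q : TM2.Stmt (fun _ : MachineStack K p.Node => Bool) (Phase ⊕ p.Label) (σ × Option Bool)}
    (hq : (machine p inp out start ask).program l = q)
    {v : σ × Option Bool} {S : MachineStack K p.Node → List Bool}
    {c : TM2.Cfg (fun _ : MachineStack K p.Node => Bool) (Phase ⊕ p.Label) (σ × Option Bool)}
    (h : TM2.stepAux q v S = c) :
    (machine p inp out start ask).OrdinaryPath 1 ⟨some l, v, S⟩ c := by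
  subst hq h
  exact OracleTM.OrdinaryPath.single hl

-- The letters on the two stacks of the loop always add up to `N`: they move from the clock to the
-- other stack while the body is iterated, and back afterwards. So the loop leaves all clocks as it
-- found them. The body has to be controlled for every position `m` of the clock.
omit [DecidableEq K] in
theorem path_loop (N : ℕ) (e : List Bool) (f : σ × (K → List Bool) → σ × (K → List Bool))
    (T : ℕ) (n : p.Node) {lt lr lb exit : Phase ⊕ p.Label}
    (hkt : (machine p inp out start ask).kind lt = .ordinary)
    (hkr : (machine p inp out start ask).kind lr = .ordinary)
    (hpt : (machine p inp out start ask).program lt = loopTest n lb lr)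
    (hpr : (machine p inp out start ask).program lr = loopRestore n lr exit)
    (c a : p.Node → ℕ) (hc : c n = N) (ha : a n = 0)
    (hbody : ∀ m (v : σ) (b : Option Bool) (S : K → List Bool), ∃ t ≤ T, ∃ b',
      (machine p inp out start ask).OrdinaryPath t
        ⟨some lb, (v, b), contents S e (letI := Classical.decEq p.Node; Function.update c n m)
          (letI := Classical.decEq p.Node; Function.update a n (N - m))⟩
        ⟨some lt, ((f (v, S)).1, b'), contents (f (v, S)).2 e
          (letI := Classical.decEq p.Node; Function.update c n m)
          (letI := Classical.decEq p.Node; Function.update a n (N - m))⟩)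
    (v : σ) (b : Option Bool) (S : K → List Bool) :
    ∃ t ≤ N * (1 + T) + 1 + (N + 1), ∃ b', (machine p inp out start ask).OrdinaryPath t
      ⟨some lt, (v, b), contents S e c a⟩
      ⟨some exit, ((f^[N] (v, S)).1, b'), contents (f^[N] (v, S)).2 e c a⟩ := by
  let := Classical.decEq p.Node
  have ec : Function.update c n N = c := Function.update_eq_self_iff.2 hc.symm
  have ea : Function.update a n 0 = a := Function.update_eq_self_iff.2 ha.symm
  -- The iterations: `m` letters are left on the clock, and `N - m` have been spent.
  obtain ⟨t₁, ht₁, d₁, h₁, -, b₁, rfl⟩ := path_iterate (M := machine p inp out start ask)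
    (C := fun m x d => m ≤ N ∧ ∃ b, d = ⟨some lt, (x.1, b),
      contents x.2 e (Function.update c n m) (Function.update a n (N - m))⟩)
    (T := 1 + T) (f := f) (by
      rintro m ⟨v, S⟩ d ⟨hm, b, rfl⟩
      obtain ⟨t₁, ht₁, b₁, h₁⟩ := hbody m v (some true) S
      refine ⟨1 + t₁, by omega, _, (path_single hkt hpt
        ((stepAux_loopTest_succ _ _ _ _ _ _ _ _ _).trans ?_)).trans h₁, by omega, b₁, rfl⟩
      have : N - m = N - (m + 1) + 1 := by omega
      simp [this]
      rfl)
    N (v, S) ⟨some lt, (v, b), contents S e c a⟩ ⟨le_rfl, b, by rw [Nat.sub_self, ec, ea]⟩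
  generalize f^[N] (v, S) = y at *
  -- The restoring phase: now `m` counts the spent letters that are still to be moved back, and the
  -- data `y` stay fixed.
  obtain ⟨t₃, ht₃, d₃, h₃, -, b₃, rfl⟩ := path_iterate (M := machine p inp out start ask)
    (C := fun m _ d => m ≤ N ∧ ∃ b, d = ⟨some lr, (y.1, b),
      contents y.2 e (Function.update c n (N - m)) (Function.update a n m)⟩)
    (T := 1) (f := id) (by
      rintro m _ d ⟨hm, b, rfl⟩
      refine ⟨1, le_rfl, _, path_single hkr hpr
        ((stepAux_loopRestore_succ _ _ _ _ _ _ _ _ _).trans ?_), by omega, some true, rfl⟩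
      have : N - m = N - (m + 1) + 1 := by omega
      simp [this]
      rfl)
    N () ⟨some lr, (y.1, none), contents y.2 e (Function.update c n 0) (Function.update a n N)⟩
    ⟨le_rfl, none, by rw [Nat.sub_self]⟩
  refine ⟨t₁ + (1 + (t₃ + 1)), by omega, none,
    h₁.trans ((path_single hkt hpt (stepAux_loopTest_zero _ _ _ _ _ _ _ _)).trans
      (h₃.trans (path_single hkr hpr ?_)))⟩
  refine (stepAux_loopRestore_zero _ _ _ _ _ _ _ _).trans ?_
  simp [ec, ea]
  rfl

/-- Induction on a subprogram `q` of `p`: the maps `node` and `label` place its loops and labels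
among those of `p`. Every clock of `q` has to be full at the start, and is full again at the end. -/
theorem path_code (N : ℕ) (e : List Bool) (q : Prog K σ) (node : q.Node → p.Node)
    (label : q.Label → Phase ⊕ p.Label) (exit : Phase ⊕ p.Label)
    (hnode : Function.Injective node)
    (hkind : ∀ l, (machine p inp out start ask).kind (label l) = .ordinary)
    (hprog : ∀ l, (machine p inp out start ask).program (label l) = code q node label exit l)
    (c a : p.Node → ℕ) (hc : ∀ n, c (node n) = N) (ha : ∀ n, a (node n) = 0)
    (v : σ) (b : Option Bool) (S : K → List Bool) :
    ∃ t ≤ q.time N, ∃ b', (machine p inp out start ask).OrdinaryPath t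
      ⟨some (label q.entry), (v, b), contents S e c a⟩
      ⟨some exit, ((q.exec N (v, S)).1, b'), contents (q.exec N (v, S)).2 e c a⟩ := by
  classical
  induction q generalizing exit c a v b S with
  | push k f =>
    exact ⟨1, le_rfl, b, path_single (hkind ()) (hprog ()) (by
      simp [code, exec, contents, update_contents_user]; rfl)⟩
  | pop k f =>
    exact ⟨1, le_rfl, b, path_single (hkind ()) (hprog ()) (by
      simp [code, exec, contents, update_contents_user]; rfl)⟩
  | load f =>
    exact ⟨1, le_rfl, b, path_single (hkind ()) (hprog ()) (by simp [code, exec]; rfl)⟩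
  | seq q₁ q₂ ih₁ ih₂ =>
    obtain ⟨t₁, ht₁, b₁, h₁⟩ := ih₁ (node ∘ Sum.inl) (label ∘ Sum.inl) (label (.inr (entry q₂)))
      (hnode.comp Sum.inl_injective) (fun l => hkind _) (fun l => hprog _) c a (fun n => hc _)
      (fun n => ha _) v b S
    obtain ⟨t₂, ht₂, b₂, h₂⟩ := ih₂ (node ∘ Sum.inr) (label ∘ Sum.inr) exit
      (hnode.comp Sum.inr_injective) (fun l => hkind _) (fun l => hprog _) c a (fun n => hc _)
      (fun n => ha _) (q₁.exec N (v, S)).1 b₁ (q₁.exec N (v, S)).2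
    exact ⟨t₁ + t₂, Nat.add_le_add ht₁ ht₂, b₂, h₁.trans h₂⟩
  | ite f q₁ q₂ ih₁ ih₂ =>
    cases hf : f v with
    | true =>
      obtain ⟨t₁, ht₁, b₁, h₁⟩ := ih₁ (node ∘ Sum.inl) (fun l => label (some (.inl l))) exit
        (hnode.comp Sum.inl_injective) (fun l => hkind _) (fun l => hprog _) c a (fun n => hc _)
        (fun n => ha _) v b S
      refine ⟨1 + t₁, by simp only [time]; omega, b₁, ?_⟩
      rw [exec, hf]
      exact (path_single (hkind none) (hprog none) (by simp [code, hf]; rfl)).trans h₁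
    | false =>
      obtain ⟨t₁, ht₁, b₁, h₁⟩ := ih₂ (node ∘ Sum.inr) (fun l => label (some (.inr l))) exit
        (hnode.comp Sum.inr_injective) (fun l => hkind _) (fun l => hprog _) c a (fun n => hc _)
        (fun n => ha _) v b S
      refine ⟨1 + t₁, by simp only [time]; omega, b₁, ?_⟩
      rw [exec, hf]
      exact (path_single (hkind none) (hprog none) (by simp [code, hf]; rfl)).trans h₁
  | loop q ih =>
    -- By injectivity of `node`, the loops inside the body have clocks of their own, which are full
    -- although the clock of the present loop is partly run down.
    have hne (n : q.Node) : node (some n) ≠ node none := fun h => by cases hnode h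
    refine path_loop N e (q.exec N) (q.time N) (node none) (hkind (.inl false))
      (hkind (.inl true)) (hprog (.inl false)) (hprog (.inl true)) c a (hc _) (ha _)
      (fun m v b S => ?_) v b S
    exact ih (node ∘ some) (label ∘ .inr) (label (.inl false))
      (hnode.comp (Option.some_injective _)) (fun l => hkind _) (fun l => hprog _)
      (Function.update c (node none) m) (Function.update a (node none) (N - m))
      (fun n => (Function.update_of_ne (hne n) _ _).trans (hc _))
      (fun n => (Function.update_of_ne (hne n) _ _).trans (ha _)) v b S

/-- Each letter that is moved also winds up every clock by one, so in the end all clocks show the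
input length. Moving from stack to stack reverses the input. -/
theorem path_setup (e : List Bool) (s : List Bool) (l : List Bool) (c : ℕ) (b : Option Bool)
    (hio : inp ≠ out) :
    ∃ b', (machine p inp out start ask).OrdinaryPath (s.length + 1)
      ⟨some (.inl .setup), (start, b),
        contents (Function.update (Function.update (fun _ => []) out s) inp l) e
          (fun _ => c) (fun _ => 0)⟩
      ⟨some (.inr p.entry), (start, b'),
        contents (Function.update (fun _ => []) inp (s.reverse ++ l)) e
          (fun _ => c + s.length) (fun _ => 0)⟩ := by
  classical
  induction s generalizing l c b with
  | nil =>
    exact ⟨none, path_single rfl rfl (stepAux_setupStmt_nil _ _ _ _ _ _ _ _ hio)⟩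
  | cons x s ih =>
    obtain ⟨b', h⟩ := ih (x :: l) (c + 1) (some x)
    refine ⟨b', ?_⟩
    have e₂ : (fun n : p.Node => c + List.count n
        (letI := Fintype.ofFinite p.Node; Finset.univ.toList)) = fun _ => c + 1 := by
      funext n
      let := Fintype.ofFinite p.Node
      rw [List.count_eq_one_of_mem (Finset.nodup_toList _) (by simp)]
    have h₀ := path_single (p := p) (start := start) (ask := ask) (l := .inl .setup) rfl rfl
      (stepAux_setupStmt_cons _ _ _ (start, b) s e (fun _ => c) (fun _ => 0) hio x l)
    rw [e₂] at h₀
    convert h₀.trans h using 1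
    · simp; omega
    · simp [Nat.add_assoc, Nat.add_comm 1]

/-- The state of the program at its end, on the input `s`. -/
def result (p : Prog K σ) (inp : K) (start : σ) (s : List Bool) : σ × (K → List Bool) :=
  p.exec s.length (start, Function.update (fun _ => []) inp s.reverse)

theorem initial_machine (hio : inp ≠ out) (s e : List Bool) :
    (machine p inp out start ask).initial s e = ⟨some (.inl .setup), (start, none),
      contents (Function.update (Function.update (fun _ => []) out s) inp []) e
        (fun _ => 0) (fun _ => 0)⟩ := by
  unfold OracleTM.initial
  congr 1
  funext k
  change Function.update (Function.update (fun _ => [] : MachineStack K p.Node → List Bool)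
    .err e) (.user out) s k = _
  rcases k with k | _ | k | k
  · by_cases hk : k = out
    · subst hk
      simp [contents, Function.update, hio.symm]
    · by_cases hk' : k = inp
      · subst hk'
        simp [contents, Function.update, hk]
      · simp [contents, Function.update, hk, hk']
  all_goals simp [contents, Function.update]

theorem exists_path (hio : inp ≠ out) (s e : List Bool) :
    ∃ t ≤ s.length + 1 + p.time s.length, ∃ b c a, (machine p inp out start ask).OrdinaryPath t
      ((machine p inp out start ask).initial s e)
      ⟨some (.inl .finish), ((result p inp start s).1, b),
        contents (result p inp start s).2 e c a⟩ := by
  classical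
  obtain ⟨b, h⟩ := path_setup (p := p) (inp := inp) (out := out) (start := start) (ask := ask)
    e s [] 0 none hio
  obtain ⟨t, ht, b', h'⟩ := path_code (p := p) (inp := inp) (out := out) (start := start)
    (ask := ask) s.length e p id .inr (.inl .finish) Function.injective_id (fun _ => rfl)
    (fun _ => rfl) (fun _ => 0 + s.length) (fun _ => 0) (by simp) (by simp) start b
    (Function.update (fun _ => []) inp (s.reverse ++ []))
  refine ⟨_, Nat.add_le_add_left ht _, b', fun _ => 0 + s.length, fun _ => 0, ?_⟩
  have := h.trans h'
  simp only [List.append_nil] at this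
  rwa [initial_machine hio]

end Prog

end BoundedCSP

end

/-! ### From programs to approximation-preserving reductions -/

noncomputable section

namespace BoundedCSP

open Turing

theorem exists_mvPolynomial_eval (q : Polynomial ℕ) : ∃ p : MvPolynomial (Fin 2) ℝ,
    ∀ (n : ℕ) (x : ℝ), p.eval ![(n : ℝ), x] = (q.eval n : ℕ) := by
  refine ⟨q.eval₂ (algebraMap ℕ _) (MvPolynomial.X 0), fun n x => ?_⟩
  rw [Polynomial.hom_eval₂]
  simp only [MvPolynomial.eval_X, Matrix.cons_val_zero]
  rw [Polynomial.eval₂_at_natCast]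
  simp

theorem mem_goodOutputs {ε : ℝ} (hε : 0 < ε) (y : List Bool) :
    y ∈ goodOutputs ε (outputValue y) := by
  have h : (0 : ℝ) ≤ outputValue y := Nat.cast_nonneg _
  constructor
  · exact mul_le_of_le_one_left h (Real.exp_le_one_iff.2 (by linarith))
  · exact le_mul_of_one_le_left h (Real.one_le_exp hε.le)

namespace OracleTM

variable {M : OracleTM} {O : RandomOracle} {s e : List Bool}

/-- What a machine does if it makes no oracle call. -/
theorem OrdinaryPath.of_halted {t : ℕ} {c : M.Cfg}
    (h : M.OrdinaryPath t (M.initial s e) c) (hc : c.l = none) :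
    (∀ O u d, M.CanReach O s e u d → ¬ M.IsQuery d) ∧ (∀ O, M.HaltsWithin O s e t) ∧
      ∀ O, M.outputDist O s e t = PMF.pure (c.stk M.inst) := by
  have hrun (O : RandomOracle) (u : ℕ) : M.run O (t + u) (M.initial s e) = PMF.pure c := by
    rw [h.run_add, run_halted O u hc]
  refine ⟨fun O u d hd hq => ?_, fun O d hd => ?_, fun O => ?_⟩
  · rcases lt_or_ge u t with hu | hu
    · obtain ⟨c', hc', hn⟩ := h.run_lt O hu
      rw [CanReach, hc', PMF.mem_support_pure_iff] at hd
      exact hn (hd ▸ hq)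
    · obtain ⟨k, rfl⟩ := Nat.exists_eq_add_of_le hu
      rw [CanReach, hrun, PMF.mem_support_pure_iff] at hd
      obtain ⟨l, hl, -⟩ := hq
      rw [hd, hc] at hl
      cases hl
  · rw [CanReach, ← Nat.add_zero t, hrun, PMF.mem_support_pure_iff] at hd
    rw [hd, hc]
  · rw [outputDist, ← Nat.add_zero t, hrun, PMF.pure_map]

/-- What a machine does if it makes a single oracle call, and halts then. -/
theorem OrdinaryPath.of_query {t : ℕ} {l : M.Λ} {v : M.σ} {S : M.K → List Bool}
    (h : M.OrdinaryPath t (M.initial s e) ⟨some l, v, S⟩) (hk : M.kind l = .query)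
    (hl : M.program l = .halt) :
    (∀ O u d, M.CanReach O s e u d → M.IsQuery d → d.stk = S) ∧
      (∀ O, M.HaltsWithin O s e (t + 1)) ∧
      ∀ O, M.outputDist O s e (t + 1) = O (S M.inst) (S M.err) := by
  have hrun (O : RandomOracle) (u : ℕ) : M.run O (t + (u + 1)) (M.initial s e) =
      (O (S M.inst) (S M.err)).map fun a => ⟨none, v, Function.update S M.inst a⟩ := by
    rw [h.run_add, run, step]
    simp only [hk, hl, TM2.stepAux]
    rw [PMF.bind_map]
    refine (congrArg _ (funext fun a => ?_)).trans (PMF.bind_pure_comp _ _)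
    exact run_halted O u rfl
  refine ⟨fun O u d hd hq => ?_, fun O d hd => ?_, fun O => ?_⟩
  -- Before time `t` all steps are ordinary, at time `t` the call is made, and afterwards the
  -- machine has halted.
  · rcases lt_trichotomy u t with hu | rfl | hu
    · obtain ⟨c', hc', hn⟩ := h.run_lt O hu
      rw [CanReach, hc', PMF.mem_support_pure_iff] at hd
      exact absurd (hd ▸ hq) hn
    · rw [CanReach, ← Nat.add_zero u, h.run_add, run, PMF.mem_support_pure_iff] at hd
      rw [hd]
    · obtain ⟨k, rfl⟩ := Nat.exists_eq_add_of_le' hu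
      rw [CanReach, show k + (t + 1) = t + (k + 1) by omega, hrun, PMF.mem_support_map_iff] at hd
      obtain ⟨a, -, rfl⟩ := hd
      obtain ⟨l', hl', -⟩ := hq
      cases hl'
  · rw [CanReach, hrun O 0, PMF.mem_support_map_iff] at hd
    obtain ⟨a, -, rfl⟩ := hd
    rfl
  · rw [outputDist, hrun O 0, PMF.map_comp]
    convert PMF.map_id _
    funext a
    simp

end OracleTM

namespace Prog

variable {K σ : Type} [Fintype K] [Fintype σ] [DecidableEq K]

/-- A program that either computes the number in question or turns an instance of `f` into an
instance of `g` with the same number is an approximation-preserving reduction. -/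
theorem apReducible (p : Prog K σ) {inp out : K} (hio : inp ≠ out) (start : σ) (ask : σ → Bool)
    (f g : CountingProblem)
    (h : ∀ s x, f.IsCode s x →
      (ask (p.result inp start s).1 = true ∧
        ∃ y, g.IsCode ((p.result inp start s).2 out) y ∧ g.count y = f.count x) ∨
      (ask (p.result inp start s).1 = false ∧
        outputValue ((p.result inp start s).2 out) = f.count x)) :
    APReducible f g := by
  set M := machine p inp out start ask with hM
  -- The query is made with the unchanged error bound `e`, and its count equals that of `x`; so the
  -- guarantee of the oracle is literally the one required of the machine. Two steps are added to
  -- those of setup and program: the decision whether to ask, and the call.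
  have main (s e : List Bool) (x : f.Instance) (hx : f.IsCode s x) :
      ∃ t ≤ s.length + 1 + p.time s.length + 2, (∀ O, M.HaltsWithin O s e t) ∧
        (∀ O u d, M.CanReach O s e u d → M.IsQuery d →
          (∃ y, g.IsCode (d.stk M.inst) y) ∧ d.stk M.err = e) ∧
        ((∃ z, outputValue z = f.count x ∧ ∀ O, M.outputDist O s e t = PMF.pure z) ∨
          ∃ s' y, g.IsCode s' y ∧ g.count y = f.count x ∧ ∀ O, M.outputDist O s e t = O s' e) := by
    obtain ⟨t, ht, b, c, a, hp⟩ := exists_path (p := p) (start := start) (ask := ask) hio s e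
    rcases h s x hx with ⟨hask, y, hy, hc⟩ | ⟨hask, hc⟩
    · have hp' := hp.trans (path_single (l := .inl .finish) rfl
        (q := .branch (fun v => ask v.1) (.goto fun _ => .inl .ask) .halt) rfl
        (c := ⟨some (.inl .ask), ((p.result inp start s).1, b),
          contents (p.result inp start s).2 e c a⟩) (by simp [hask]))
      obtain ⟨h₁, h₂, h₃⟩ := OracleTM.OrdinaryPath.of_query (M := M) hp' rfl rfl
      refine ⟨_, by omega, h₂, fun O u d hd hq => ?_, .inr ⟨_, y, hy, hc, h₃⟩⟩
      rw [h₁ O u d hd hq]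
      exact ⟨⟨y, hy⟩, rfl⟩
    · have hp' := hp.trans (path_single (l := .inl .finish) rfl
        (q := .branch (fun v => ask v.1) (.goto fun _ => .inl .ask) .halt) rfl
        (c := ⟨none, ((p.result inp start s).1, b),
          contents (p.result inp start s).2 e c a⟩) (by simp [hask]))
      obtain ⟨h₁, h₂, h₃⟩ := hp'.of_halted rfl
      exact ⟨_, by omega, h₂, fun O u d hd hq => absurd hq (h₁ O u d hd), .inl ⟨_, hc, h₃⟩⟩
  -- The polynomial for the queries is the variable for `ε⁻¹`, because `δ = ε`.
  refine ⟨M, ⟨.X 1, fun s x hx e he O t c hc hq => ?_⟩, fun O hO s x hx e he => ?_, ?_⟩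
  · obtain ⟨t, -, -, h₁, -⟩ := main s e x hx
    obtain ⟨h₁, h₂⟩ := h₁ O _ c hc hq
    exact ⟨h₁, by rwa [h₂], by simp [h₂]⟩
  · obtain ⟨t, -, h₁, -, ⟨z, hz, h₂⟩ | ⟨s', y, hy, hc, h₂⟩⟩ := main s e x hx
    · refine ⟨t, h₁ O, ?_⟩
      rw [h₂, PMF.toOuterMeasure_pure_apply, if_pos (hz ▸ mem_goodOutputs he.1 z)]
      exact ENNReal.div_le_of_le_mul (by norm_num)
    · refine ⟨t, h₁ O, ?_⟩
      rw [h₂, ← hc]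
      exact hO s' y hy e he
  · obtain ⟨P, hP⟩ := p.exists_time_eq_eval
    obtain ⟨q, hq⟩ := exists_mvPolynomial_eval (.X + 1 + P + 2)
    refine ⟨q, fun s x hx e he O => ?_⟩
    obtain ⟨t, ht, h₁, -⟩ := main s e x hx
    refine ⟨t, ?_, h₁ O⟩
    rw [hq]
    exact_mod_cast ht.trans (by simp [hP])

end Prog

end BoundedCSP

end

/-! ### Iterations, and rules for executing programs -/

noncomputable section

namespace BoundedCSP

theorem encodeNats_nil : encodeNats [] = [] := rfl

theorem encodeNats_cons (a : ℕ) (l : List ℕ) :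
    encodeNats (a :: l) = List.replicate a true ++ false :: encodeNats l := by
  simp [encodeNats]

theorem encodeNats_append (l l' : List ℕ) :
    encodeNats (l ++ l') = encodeNats l ++ encodeNats l' := by
  simp [encodeNats]

/-- A loop runs as often as the input has letters, usually more often than its task needs. By `hnil`
the final state is a fixed point, so the surplus iterations are harmless. `iterate_countdown` is the
analogue for counters. -/
theorem iterate_list {α β τ : Type} {F : τ → τ} {S : List α → β → τ} {h : β → α → β}
    (I : List α → β → Prop)
    (hcons : ∀ x l g, I (x :: l) g → F (S (x :: l) g) = S l (h g x) ∧ I l (h g x))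
    (hnil : ∀ g, F (S [] g) = S [] g) {n : ℕ} (l : List α) (g : β) (hn : l.length ≤ n)
    (hI : I l g) : F^[n] (S l g) = S [] (l.foldl h g) := by
  induction l generalizing n g with
  | nil => exact Function.iterate_fixed (hnil g) n
  | cons x l ih =>
    obtain ⟨n, rfl⟩ : ∃ k, n = k + 1 := ⟨n - 1, by simp at hn; omega⟩
    rw [Function.iterate_succ_apply, (hcons x l g hI).1]
    exact ih _ (by simpa using hn) (hcons x l g hI).2

theorem iterate_countdown {β τ : Type} {F : τ → τ} {S : ℕ → β → τ} {h : β → β}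
    (hsucc : ∀ a g, F (S (a + 1) g) = S a (h g)) (hzero : ∀ g, F (S 0 g) = S 0 g)
    {n : ℕ} (a : ℕ) (g : β) (hn : a ≤ n) : F^[n] (S a g) = S 0 (h^[a] g) := by
  induction a generalizing n g with
  | zero => exact Function.iterate_fixed (hzero g) n
  | succ a ih =>
    obtain ⟨n, rfl⟩ : ∃ k, n = k + 1 := ⟨n - 1, by omega⟩
    rw [Function.iterate_succ_apply, hsucc]
    exact ih _ (by omega)

theorem iterate_eq_of_step {α : Type} {h : α → α} {f : ℕ → α} (hf : ∀ a, h (f a) = f (a + 1))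
    (n a : ℕ) : h^[n] (f a) = f (a + n) := by
  induction n generalizing a with
  | zero => rfl
  | succ n ih => rw [Function.iterate_succ_apply, hf, ih]; congr 1; omega

namespace Prog

variable {K σ : Type}

/-- The program that does nothing. -/
def skip : Prog K σ := load id

/-- Execute programs one after the other. -/
def seqs (l : List (Prog K σ)) : Prog K σ := l.foldr seq skip

section exec

variable [DecidableEq K] (N : ℕ)

@[simp] theorem exec_skip (s : σ × (K → List Bool)) : exec N skip s = s := rfl

@[simp] theorem exec_seq (p q : Prog K σ) (s : σ × (K → List Bool)) :
    exec N (seq p q) s = exec N q (exec N p s) := rfl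

@[simp] theorem exec_seqs_nil (s : σ × (K → List Bool)) : exec N (seqs []) s = s := rfl

@[simp] theorem exec_seqs_cons (p : Prog K σ) (l : List (Prog K σ)) (s : σ × (K → List Bool)) :
    exec N (seqs (p :: l)) s = exec N (seqs l) (exec N p s) := rfl

theorem exec_loop (p : Prog K σ) (s : σ × (K → List Bool)) :
    exec N (loop p) s = (exec N p)^[N] s := rfl

theorem exec_seqs_map {α β : Type} {f : α → Prog K σ} {S : β → σ × (K → List Bool)}
    {h : β → α → β} (I : β → Prop) (l : List α)
    (H : ∀ x ∈ l, ∀ g, I g → exec N (f x) (S g) = S (h g x) ∧ I (h g x)) (g : β) (hg : I g) :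
    exec N (seqs (l.map f)) (S g) = S (l.foldl h g) := by
  induction l generalizing g with
  | nil => rfl
  | cons x l ih =>
    obtain ⟨h₁, h₂⟩ := H x (by simp) g hg
    rw [List.map_cons, exec_seqs_cons, h₁]
    exact ih (fun y hy => H y (by simp [hy])) _ h₂

end exec

end Prog

/-! ### The stacks and the internal state of the reduction -/

/-- The stacks: the constraints still to be read and those already read, the marks of the variables,
some marks held in reserve, a scratch counter, the output, a counter for the number of variables,
and one for each position of a scope. -/
inductive Stk (m : ℕ)
  | inp
  | rev
  | bad
  | held
  | tmp
  | out
  | reg (j : Option (Fin m))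

/-- The internal state: the letter that was popped last, whether the current number has been read,
the name of the current relation, whether a contradiction was found, and the marks of the
variables in the current scope. -/
structure Ctl (q m : ℕ) where
  bit : Option Bool
  done : Bool
  -- The type `Fin (q + 1)`, unlike `Fin q`, contains 0 also if there are no relations; relation `i`
  -- is named by `i.castSucc`.
  name : Fin (q + 1)
  fail : Bool
  bits : Fin m → Bool

variable {q m : ℕ}

instance : Finite (Stk m) :=
  Finite.of_injective (fun k : Stk m => match k with
    | .inp => (Sum.inl 0 : Fin 6 ⊕ Option (Fin m))
    | .rev => Sum.inl 1
    | .bad => Sum.inl 2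
    | .held => Sum.inl 3
    | .tmp => Sum.inl 4
    | .out => Sum.inl 5
    | .reg j => Sum.inr j)
    (by rintro (_ | _ | _ | _ | _ | _ | _) (_ | _ | _ | _ | _ | _ | _) h <;> simp_all)

instance : Fintype (Stk m) := Fintype.ofFinite _

instance : DecidableEq (Stk m) := Classical.decEq _

instance : Finite (Ctl q m) :=
  Finite.of_injective (fun c : Ctl q m => (c.bit, c.done, c.name, c.fail, c.bits))
    (by rintro ⟨⟩ ⟨⟩ h; simp_all)

instance : Fintype (Ctl q m) := Fintype.ofFinite _

/-- The state with the given contents of the stacks. -/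
def st (c : Ctl q m) (inp rev bad held out : List Bool) (tmp : ℕ) (reg : Option (Fin m) → ℕ) :
    Ctl q m × (Stk m → List Bool) :=
  (c, fun k => match k with
    | .inp => inp
    | .rev => rev
    | .bad => bad
    | .held => held
    | .tmp => List.replicate tmp true
    | .out => out
    | .reg j => List.replicate (reg j) true)

namespace Prog

section primitives

variable (N : ℕ) (c : Ctl q m) (i r b h o : List Bool) (t : ℕ) (g : Option (Fin m) → ℕ)

@[simp] theorem exec_load (f : Ctl q m → Ctl q m) :
    exec N (load f) (st c i r b h o t g) = st (f c) i r b h o t g := rfl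

@[simp] theorem exec_ite (f : Ctl q m → Bool) (p p' : Prog (Stk m) (Ctl q m)) :
    exec N (ite f p p') (st c i r b h o t g) =
      if f c then exec N p (st c i r b h o t g) else exec N p' (st c i r b h o t g) := by
  simp only [exec, st]
  cases f c <;> rfl

@[simp] theorem exec_push_inp (f : Ctl q m → Bool) :
    exec N (push .inp f) (st c i r b h o t g) = st c (f c :: i) r b h o t g := by
  refine Prod.ext rfl (funext fun k => ?_)
  cases k <;> simp [exec, st]

@[simp] theorem exec_push_rev (f : Ctl q m → Bool) :
    exec N (push .rev f) (st c i r b h o t g) = st c i (f c :: r) b h o t g := by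
  refine Prod.ext rfl (funext fun k => ?_)
  cases k <;> simp [exec, st]

@[simp] theorem exec_push_bad (f : Ctl q m → Bool) :
    exec N (push .bad f) (st c i r b h o t g) = st c i r (f c :: b) h o t g := by
  refine Prod.ext rfl (funext fun k => ?_)
  cases k <;> simp [exec, st]

@[simp] theorem exec_push_held (f : Ctl q m → Bool) :
    exec N (push .held f) (st c i r b h o t g) = st c i r b (f c :: h) o t g := by
  refine Prod.ext rfl (funext fun k => ?_)
  cases k <;> simp [exec, st]

@[simp] theorem exec_push_out (f : Ctl q m → Bool) :
    exec N (push .out f) (st c i r b h o t g) = st c i r b h (f c :: o) t g := by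
  refine Prod.ext rfl (funext fun k => ?_)
  cases k <;> simp [exec, st]

@[simp] theorem exec_push_tmp :
    exec N (push .tmp fun _ => true) (st c i r b h o t g) = st c i r b h o (t + 1) g := by
  refine Prod.ext rfl (funext fun k => ?_)
  cases k <;> simp [exec, st, List.replicate_succ]

@[simp] theorem exec_push_reg (j : Option (Fin m)) :
    exec N (push (.reg j) fun _ => true) (st c i r b h o t g) =
      st c i r b h o t (Function.update g j (g j + 1)) := by
  refine Prod.ext rfl (funext fun k => ?_)
  cases k with
  | reg k =>
    by_cases hk : k = j
    · subst hk; simp [exec, st, List.replicate_succ]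
    · simp [exec, st, hk]
  | _ => simp [exec, st]

@[simp] theorem exec_pop_inp (f : Ctl q m → Option Bool → Ctl q m) :
    exec N (pop .inp f) (st c i r b h o t g) = st (f c i.head?) i.tail r b h o t g := by
  refine Prod.ext rfl (funext fun k => ?_)
  cases k <;> simp [exec, st]

@[simp] theorem exec_pop_rev (f : Ctl q m → Option Bool → Ctl q m) :
    exec N (pop .rev f) (st c i r b h o t g) = st (f c r.head?) i r.tail b h o t g := by
  refine Prod.ext rfl (funext fun k => ?_)
  cases k <;> simp [exec, st]

@[simp] theorem exec_pop_bad (f : Ctl q m → Option Bool → Ctl q m) :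
    exec N (pop .bad f) (st c i r b h o t g) = st (f c b.head?) i r b.tail h o t g := by
  refine Prod.ext rfl (funext fun k => ?_)
  cases k <;> simp [exec, st]

@[simp] theorem exec_pop_held (f : Ctl q m → Option Bool → Ctl q m) :
    exec N (pop .held f) (st c i r b h o t g) = st (f c h.head?) i r b h.tail o t g := by
  refine Prod.ext rfl (funext fun k => ?_)
  cases k <;> simp [exec, st]

@[simp] theorem exec_pop_tmp (f : Ctl q m → Option Bool → Ctl q m) :
    exec N (pop .tmp f) (st c i r b h o t g) =
      st (f c (List.replicate t true).head?) i r b h o (t - 1) g := by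
  refine Prod.ext rfl (funext fun k => ?_)
  cases k <;> simp [exec, st]

@[simp] theorem exec_pop_reg (j : Option (Fin m)) (f : Ctl q m → Option Bool → Ctl q m) :
    exec N (pop (.reg j) f) (st c i r b h o t g) =
      st (f c (List.replicate (g j) true).head?) i r b h o t
        (Function.update g j (g j - 1)) := by
  refine Prod.ext rfl (funext fun k => ?_)
  cases k with
  | reg k =>
    by_cases hk : k = j
    · subst hk; simp [exec, st]
    · simp [exec, st, hk]
  | _ => simp [exec, st]

end primitives

/-! ### Subroutines -/

/-- If the stack `k` is not empty, pop a letter and execute `p`. -/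
def whenPop (k : Stk m) (p : Prog (Stk m) (Ctl q m)) : Prog (Stk m) (Ctl q m) :=
  seqs [pop k fun v x => { v with bit := x }, ite (fun v => v.bit.isSome) p skip,
    load fun v => { v with bit := none }]

/-- Move a letter from one stack to another. -/
def move (k l : Stk m) : Prog (Stk m) (Ctl q m) :=
  whenPop k (push l fun v => v.bit.getD false)

/-- Put back what has been read. -/
def rewind : Prog (Stk m) (Ctl q m) := loop (move .rev .inp)

/-- Bring the mark of the variable in position `j` to the top, execute `p` and go back. -/
def atIndex (j : Fin m) (p : Prog (Stk m) (Ctl q m)) : Prog (Stk m) (Ctl q m) :=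
  seqs [loop (whenPop (.reg (some j)) (seqs [push .tmp fun _ => true, move .bad .held])), p,
    loop (whenPop .tmp (seqs [push (.reg (some j)) fun _ => true, move .held .bad]))]

/-- Look up the mark of the variable in position `j`. -/
def lookup (j : Fin m) : Prog (Stk m) (Ctl q m) :=
  atIndex j (seqs [pop .bad fun v x => { v with bit := x },
    load fun v => { v with bits := Function.update v.bits j (v.bit.getD false) },
    push .bad fun v => v.bit.getD false, load fun v => { v with bit := none }])

/-- Mark the variable in position `j`. -/
def mark (j : Fin m) : Prog (Stk m) (Ctl q m) :=
  atIndex j (seqs [pop .bad fun v _ => v, push .bad fun _ => true])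

/-- Read a number, and execute `p` as many times. -/
def readNat (p : Prog (Stk m) (Ctl q m)) : Prog (Stk m) (Ctl q m) :=
  seqs [loop (ite (fun v => v.done) skip
    (seqs [pop .inp fun v x => { v with bit := x }, push .rev fun v => v.bit.getD false,
      ite (fun v => v.bit.getD false) (seqs [load fun v => { v with bit := none }, p])
        (load fun v => { v with bit := none, done := true })])),
    load fun v => { v with done := false }]

/-- Write the number in a counter. -/
def emit (j : Option (Fin m)) : Prog (Stk m) (Ctl q m) :=
  seqs [push .out fun _ => false,
    loop (whenPop (.reg j) (seqs [push .out fun _ => true, push .tmp fun _ => true])),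
    loop (whenPop .tmp (push (.reg j) fun _ => true))]

section subroutines

variable {N : ℕ} (nm : Fin (q + 1)) (fl : Bool) (bs : Fin m → Bool) (i r b h o : List Bool)
  (t : ℕ) (g : Option (Fin m) → ℕ)

theorem exec_rewind (hr : r.length ≤ N) :
    exec N rewind (st ⟨none, false, nm, fl, bs⟩ i r b h o t g) =
      st ⟨none, false, nm, fl, bs⟩ (r.reverse ++ i) [] b h o t g := by
  have := iterate_list (F := exec N (move .rev .inp))
    (S := fun r i => st ⟨none, false, nm, fl, bs⟩ i r b h o t g) (h := fun i x => x :: i)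
    (fun _ _ => True) (by simp [move, whenPop]) (by simp [move, whenPop]) r i hr trivial
  simpa [rewind, exec_loop] using this

theorem exec_clear_rev (hr : r.length ≤ N) (c : Ctl q m) :
    exec N (loop (pop .rev fun v _ => v)) (st c i r b h o t g) = st c i [] b h o t g := by
  have := iterate_list (F := exec N (pop .rev fun v _ => v))
    (S := fun r (_ : Unit) => st c i r b h o t g) (h := fun i _ => i)
    (fun _ _ => True) (by simp) (by simp) r () hr trivial
  simpa [exec_loop] using this

theorem exec_clear_reg (j : Option (Fin m)) (hj : g j ≤ N) (c : Ctl q m) :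
    exec N (loop (pop (.reg j) fun v _ => v)) (st c i r b h o t g) =
      st c i r b h o t (Function.update g j 0) := by
  have := iterate_countdown (F := exec N (pop (.reg j) fun v _ => v))
    (S := fun a (_ : Unit) => st c i r b h o t (Function.update g j a)) (h := id)
    (by simp) (by simp) (g j) () hj
  simpa [exec_loop] using this

/-- Random access on a stack: the letters `l₁` above the wanted one are moved to `held` while the
counter is transferred to `tmp`, and `tmp` then tells how many to move back. In between `p` sees the
letter `x` on top and may replace it. -/
theorem exec_atIndex (j : Fin m) (p : Prog (Stk m) (Ctl q m)) (l₁ l₂ : List Bool) (x x' : Bool)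
    (bs' : Fin m → Bool) (hj : g (some j) = l₁.length) (hN : l₁.length ≤ N)
    (hp : exec N p (st ⟨none, false, nm, fl, bs⟩ i r (x :: l₂) l₁.reverse o l₁.length
        (Function.update g (some j) 0)) =
      st ⟨none, false, nm, fl, bs'⟩ i r (x' :: l₂) l₁.reverse o l₁.length
        (Function.update g (some j) 0)) :
    exec N (atIndex j p) (st ⟨none, false, nm, fl, bs⟩ i r (l₁ ++ x :: l₂) [] o 0 g) =
      st ⟨none, false, nm, fl, bs'⟩ i r (l₁ ++ x' :: l₂) [] o 0 g := by
  have h₁ := iterate_list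
    (F := exec N (whenPop (.reg (some j)) (seqs [push .tmp fun _ => true, move .bad .held])))
    (S := fun l s => st ⟨none, false, nm, fl, bs⟩ i r (l ++ x :: l₂) s o s.length
      (Function.update g (some j) l.length)) (h := fun s y => y :: s)
    (fun _ _ => True) (by simp [move, whenPop, List.replicate_succ])
    (by simp [move, whenPop]) l₁ [] hN trivial
  have h₂ := iterate_list
    (F := exec N (whenPop .tmp (seqs [push (.reg (some j)) fun _ => true, move .held .bad])))
    (S := fun l s => st ⟨none, false, nm, fl, bs'⟩ i r (s.2 ++ x' :: l₂) l o l.length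
      (Function.update g (some j) s.1)) (h := fun s y => (s.1 + 1, y :: s.2))
    (fun _ _ => True) (by simp [move, whenPop, List.replicate_succ])
    (by simp [move, whenPop]) l₁.reverse (0, []) (by simpa using hN) trivial
  have h₃ (l : List Bool) (s : ℕ × List Bool) :
      l.foldl (fun s y => (s.1 + 1, y :: s.2)) s = (s.1 + l.length, l.reverse ++ s.2) := by
    induction l generalizing s with
    | nil => simp
    | cons y l ih => simp [ih]; omega
  have h₄ (l s : List Bool) : l.foldl (fun s y => y :: s) s = l.reverse ++ s := by
    induction l generalizing s with
    | nil => simp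
    | cons y l ih => simp [ih]
  rw [h₃] at h₂
  rw [h₄] at h₁
  simp only [List.length_nil, ← hj, Function.update_eq_self, List.append_nil, List.nil_append,
    List.length_reverse, List.reverse_reverse, zero_add] at h₁ h₂
  simp only [atIndex, exec_seqs_cons, exec_seqs_nil, exec_loop, h₁]
  rw [hj] at *
  rw [hp, h₂]

theorem exec_lookup (j : Fin m) (hj : g (some j) < b.length) (hN : g (some j) ≤ N) :
    exec N (lookup j) (st ⟨none, false, nm, fl, bs⟩ i r b [] o 0 g) =
      st ⟨none, false, nm, fl, Function.update bs j (b.getD (g (some j)) false)⟩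
        i r b [] o 0 g := by
  have hb : b = b.take (g (some j)) ++ b[g (some j)] :: b.drop (g (some j) + 1) := by simp
  have hl : g (some j) = (b.take (g (some j))).length := by simp [hj.le]
  have := exec_atIndex nm fl bs i r o g j (seqs [pop .bad fun v x => { v with bit := x },
    load fun v => { v with bits := Function.update v.bits j (v.bit.getD false) },
    push .bad fun v => v.bit.getD false, load fun v => { v with bit := none }])
    (b.take (g (some j))) (b.drop (g (some j) + 1)) (b[g (some j)]) (b[g (some j)])
    (Function.update bs j (b.getD (g (some j)) false)) hl (N := N) (by omega) (by simp [hj])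
  rwa [← hb] at this

theorem exec_mark (j : Fin m) (hj : g (some j) < b.length) (hN : g (some j) ≤ N) :
    exec N (mark j) (st ⟨none, false, nm, fl, bs⟩ i r b [] o 0 g) =
      st ⟨none, false, nm, fl, bs⟩ i r (b.set (g (some j)) true) [] o 0 g := by
  have hb : b = b.take (g (some j)) ++ b[g (some j)] :: b.drop (g (some j) + 1) := by simp
  have hl : g (some j) = (b.take (g (some j))).length := by simp [hj.le]
  have := exec_atIndex nm fl bs i r o g j (seqs [pop .bad fun v _ => v, push .bad fun _ => true])
    (b.take (g (some j))) (b.drop (g (some j) + 1)) (b[g (some j)]) true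
    bs hl (N := N) (by omega) (by simp)
  rw [← hb] at this
  rw [List.set_eq_take_append_cons_drop, if_pos hj]
  exact this

/-- The type `γ` abstracts what `p` may change, and `f` is its effect there. The letter 0 at the end
of a number sets the flag `done`, after which the remaining iterations are idle. -/
theorem exec_readNat {γ : Type} (p : Prog (Stk m) (Ctl q m)) (nm : γ → Fin (q + 1))
    (bd : γ → List Bool) (rg : γ → Option (Fin m) → ℕ) (f : γ → γ)
    (hp : ∀ x i r, exec N p (st ⟨none, false, nm x, fl, bs⟩ i r (bd x) [] o 0 (rg x)) =
      st ⟨none, false, nm (f x), fl, bs⟩ i r (bd (f x)) [] o 0 (rg (f x)))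
    (a : ℕ) (ha : a + 1 ≤ N) (x : γ) :
    exec N (readNat p) (st ⟨none, false, nm x, fl, bs⟩ (List.replicate a true ++ false :: i) r
        (bd x) [] o 0 (rg x)) =
      st ⟨none, false, nm (f^[a] x), fl, bs⟩ i ((List.replicate a true ++ [false]).reverse ++ r)
        (bd (f^[a] x)) [] o 0 (rg (f^[a] x)) := by
  have h₁ := iterate_list
    (F := exec N (ite (fun v : Ctl q m => v.done) skip
      (seqs [pop .inp fun v x => { v with bit := x }, push .rev fun v => v.bit.getD false,
        ite (fun v => v.bit.getD false) (seqs [load fun v => { v with bit := none }, p])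
          (load fun v => { v with bit := none, done := true })])))
    -- Here `l` is the unread rest of the number; the flag `done` is set exactly when `l` is empty.
    -- The invariant below says that `l` is empty or of the form `1^a 0`.
    (S := fun l (s : List Bool × γ) => st ⟨none, l.isEmpty, nm s.2, fl, bs⟩ (l ++ i) s.1
      (bd s.2) [] o 0 (rg s.2)) (h := fun s y => (y :: s.1, cond y (f s.2) s.2))
    (fun l _ => l = [] ∨ ∃ a, l = List.replicate a true ++ [false]) (by
      rintro y l ⟨s, x⟩ (h | ⟨a, h⟩)
      · cases h
      · cases a with
        | zero => simp_all
        | succ a =>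
          simp only [List.replicate_succ, List.cons_append, List.cons.injEq] at h
          obtain ⟨rfl, rfl⟩ := h
          have : (List.replicate a true ++ [false]).isEmpty = false := by cases a <;> rfl
          simp [hp, this])
    (by simp) (List.replicate a true ++ [false]) (r, x) (by simpa using ha) (.inr ⟨a, rfl⟩)
  have h₃ (a : ℕ) (s : List Bool × γ) :
      (List.replicate a true ++ [false]).foldl (fun s y => (y :: s.1, cond y (f s.2) s.2)) s =
        ((List.replicate a true ++ [false]).reverse ++ s.1, f^[a] s.2) := by
    induction a generalizing s with
    | zero => simp
    | succ a ih => simp [List.replicate_succ, ih]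
  rw [h₃] at h₁
  simp only [readNat, exec_seqs_cons, exec_seqs_nil, exec_loop]
  simp only [List.append_assoc, List.cons_append, List.nil_append] at h₁
  have h₄ : (List.replicate a true ++ [false]).isEmpty = false := by simp
  rw [h₄] at h₁
  erw [h₁]
  simp

/-- The output is built from its end, so the final 0 is pushed before the letters 1. The counter is
transferred to `tmp` meanwhile and then restored. -/
theorem exec_emit (j : Option (Fin m)) (hj : g j ≤ N) :
    exec N (emit j) (st ⟨none, false, nm, fl, bs⟩ i r b h o 0 g) =
      st ⟨none, false, nm, fl, bs⟩ i r b h (encodeNats [g j] ++ o) 0 g := by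
  have h₁ := iterate_countdown
    (F := exec N (whenPop (.reg j) (seqs [push .out fun _ => true, push .tmp fun _ => true])))
    (S := fun a (s : List Bool × ℕ) => st ⟨none, false, nm, fl, bs⟩ i r b h s.1 s.2
      (Function.update g j a)) (h := fun s => (true :: s.1, s.2 + 1))
    (by simp [whenPop, List.replicate_succ]) (by simp [whenPop]) (g j) (false :: o, 0) hj
  have h₂ := iterate_countdown
    (F := exec N (whenPop .tmp (push (.reg j) fun _ => true)))
    (S := fun a s => st ⟨none, false, nm, fl, bs⟩ i r b h (encodeNats [g j] ++ o) a
      (Function.update g j s)) (h := fun s => s + 1)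
    (by simp [whenPop, List.replicate_succ]) (by simp [whenPop]) (g j) 0 hj
  have h₃ := iterate_eq_of_step (h := fun s : List Bool × ℕ => (true :: s.1, s.2 + 1))
    (f := fun a => (List.replicate a true ++ false :: o, a))
    (by simp [List.replicate_succ]) (g j) 0
  have h₄ := iterate_eq_of_step (h := fun s : ℕ => s + 1) (f := id) (by simp) (g j) 0
  simp only [id, List.replicate_zero, List.nil_append] at h₃ h₄
  rw [h₃] at h₁
  rw [h₄] at h₂
  simp only [zero_add, Function.update_eq_self] at h₁ h₂
  simp only [emit, exec_seqs_cons, exec_seqs_nil, exec_loop, exec_push_out, h₁]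
  simpa [encodeNats] using h₂

end subroutines

end Prog

end BoundedCSP

end

/-! ### Reading the list of constraints -/

noncomputable section

namespace BoundedCSP

variable {q m : ℕ}

/-- The code of a list of hyper-edges. -/
def encodeEdges (L : List (List ℕ)) : List Bool := encodeNats (L.flatMap fun l => l.length :: l)

theorem encodeEdges_append (L L' : List (List ℕ)) :
    encodeEdges (L ++ L') = encodeEdges L ++ encodeEdges L' := by
  simp [encodeEdges, encodeNats_append]

/-- What is pushed last on the output stack stands first in the string; this explains the reversals
in all descriptions of the output. -/
theorem foldl_encodeEdges {α : Type} (f : α → List (List ℕ)) (l : List α) (o : List Bool) :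
    l.foldl (fun o c => encodeEdges (f c) ++ o) o = encodeEdges (l.reverse.flatMap f) ++ o := by
  induction l generalizing o with
  | nil => simp [encodeEdges, encodeNats]
  | cons c l ih => simp [ih, encodeEdges_append]

/-- A constraint, given by the name of its relation and its scope, a function on the positions. -/
abbrev RawConstraint (q m : ℕ) : Type := Fin q × (Fin m → ℕ)

/-- The code of a constraint, where `pos i` lists the positions for the relation `i`. -/
def rawCode (pos : Fin q → List (Fin m)) (c : RawConstraint q m) : List Bool :=
  encodeNats ((c.1 : ℕ) :: (pos c.1).map c.2)

/-- The constraint `c` on `n` variables can be read by a machine whose loops are executed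
`N` times. -/
structure Readable (pos : Fin q → List (Fin m)) (N n : ℕ) (c : RawConstraint q m) : Prop where
  lt : ∀ j ∈ pos c.1, c.2 j < n
  -- The counters of positions that the relation does not have stay empty.
  eq_zero : ∀ j ∉ pos c.1, c.2 j = 0
  length_le : (rawCode pos c).length ≤ N

theorem length_encodeNats_cons (a : ℕ) (l : List ℕ) :
    (encodeNats (a :: l)).length = a + 1 + (encodeNats l).length := by
  simp [encodeNats_cons]; omega

theorem lt_length_encodeNats {a : ℕ} {l : List ℕ} (h : a ∈ l) : a < (encodeNats l).length := by
  induction l with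
  | nil => cases h
  | cons b l ih =>
    rw [length_encodeNats_cons]
    rcases List.mem_cons.1 h with rfl | h
    · omega
    · have := ih h; omega

theorem Readable.name_lt {pos : Fin q → List (Fin m)} {N n : ℕ} {c : RawConstraint q m}
    (h : Readable pos N n c) : (c.1 : ℕ) < N :=
  (lt_length_encodeNats (by simp)).trans_le h.length_le

theorem Readable.var_lt {pos : Fin q → List (Fin m)} {N n : ℕ} {c : RawConstraint q m}
    (h : Readable pos N n c) {j : Fin m} (hj : j ∈ pos c.1) : c.2 j < N :=
  (lt_length_encodeNats (List.mem_cons_of_mem _ (List.mem_map_of_mem hj))).trans_le h.length_le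

theorem Readable.var_le {pos : Fin q → List (Fin m)} {N n : ℕ} {c : RawConstraint q m}
    (h : Readable pos N n c) (j : Fin m) : c.2 j ≤ N := by
  by_cases hj : j ∈ pos c.1
  · exact (h.var_lt hj).le
  · simp [h.eq_zero j hj]

/-- The counters for `n` variables and the scope `X`. -/
def counters (n : ℕ) (X : Fin m → ℕ) : Option (Fin m) → ℕ
  | none => n
  | some j => X j

/-- The marks of the variables in the scope of `c`. -/
def scopeMarks (pos : Fin q → List (Fin m)) (b : List Bool) (c : RawConstraint q m) :
    Fin m → Bool :=
  fun j => if j ∈ pos c.1 then b.getD (c.2 j) false else false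

namespace Prog

/-- Execute the program for the current relation. -/
def onName (P : Fin q → Prog (Stk m) (Ctl q m)) : Prog (Stk m) (Ctl q m) :=
  (List.finRange q).foldr (fun i p => ite (fun v => decide (v.name = i.castSucc)) (P i) p) skip

def readReg (j : Fin m) : Prog (Stk m) (Ctl q m) :=
  readNat (push (.reg (some j)) fun _ => true)

def clearRegs : Prog (Stk m) (Ctl q m) :=
  seqs ((List.finRange m).map fun j => loop (pop (.reg (some j)) fun v _ => v))

/-- Read a constraint, look up the marks of the variables in its scope, and execute the program for
its relation. -/
def constraintStep (pos : Fin q → List (Fin m)) (P : Fin q → Prog (Stk m) (Ctl q m)) :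
    Prog (Stk m) (Ctl q m) :=
  -- The first letter is only inspected and then put back. If there is none, nothing happens, so a
  -- whole pass can be a loop of this step.
  seqs [pop .inp fun v x => { v with bit := x },
    ite (fun v => v.bit.isSome)
      (seqs [push .inp fun v => v.bit.getD false, load fun v => { v with bit := none },
        readNat (load fun v => { v with name := v.name + 1 }),
        onName fun i => seqs ((pos i).map readReg),
        onName fun i => seqs ((pos i).map lookup),
        onName P, clearRegs,
        load fun v => { v with name := 0, bits := fun _ => false }])
      skip]

variable {N : ℕ}

theorem exec_onName (P : Fin q → Prog (Stk m) (Ctl q m)) (i₀ : Fin q) (b : Option Bool) (d fl : Bool)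
    (bs : Fin m → Bool) (i r bd h o : List Bool) (t : ℕ) (g : Option (Fin m) → ℕ) :
    exec N (onName P) (st ⟨b, d, i₀.castSucc, fl, bs⟩ i r bd h o t g) =
      exec N (P i₀) (st ⟨b, d, i₀.castSucc, fl, bs⟩ i r bd h o t g) := by
  have (l : List (Fin q)) (hl : i₀ ∈ l) : exec N
      (l.foldr (fun i p => ite (fun v => decide (v.name = i.castSucc)) (P i) p) skip)
        (st ⟨b, d, i₀.castSucc, fl, bs⟩ i r bd h o t g) =
      exec N (P i₀) (st ⟨b, d, i₀.castSucc, fl, bs⟩ i r bd h o t g) := by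
    induction l with
    | nil => cases hl
    | cons j l ih =>
      by_cases hj : i₀ = j
      · subst hj; simp
      · have := ih (by simpa [hj] using hl)
        simpa [Fin.castSucc_inj, hj] using this
  exact this _ (List.mem_finRange _)

theorem exec_readRegs (nm : Fin (q + 1)) (fl : Bool) (bs : Fin m → Bool) (i r b o : List Bool)
    (g : Option (Fin m) → ℕ) (l : List (Fin m)) (X : Fin m → ℕ) (hX : ∀ j ∈ l, X j < N) :
    exec N (seqs (l.map readReg)) (st ⟨none, false, nm, fl, bs⟩ (encodeNats (l.map X) ++ i) r b []
        o 0 g) =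
      st ⟨none, false, nm, fl, bs⟩ i ((encodeNats (l.map X)).reverse ++ r) b [] o 0
        (l.foldl (fun g j => Function.update g (some j) (g (some j) + X j)) g) := by
  induction l generalizing g r with
  | nil => simp [encodeNats]
  | cons j l ih =>
    have h₁ := exec_readNat (N := N) fl bs (encodeNats (l.map X) ++ i) r o
      (push (.reg (some j)) fun _ => true) (fun _ => nm) (fun _ => b) id
      (fun g => Function.update g (some j) (g (some j) + 1)) (by simp) (X j)
      (hX j (by simp)) g
    have h₂ := iterate_eq_of_step
      (h := fun g : Option (Fin m) → ℕ => Function.update g (some j) (g (some j) + 1))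
      (f := fun a => Function.update g (some j) (g (some j) + a)) (by simp [Nat.add_assoc])
      (X j) 0
    simp only [add_zero, Function.update_eq_self, zero_add] at h₂
    simp only [h₂, id] at h₁
    simp only [List.map_cons, exec_seqs_cons, encodeNats_cons, List.foldl_cons, List.append_assoc,
      List.cons_append]
    rw [readReg, h₁, ih _ _ fun k hk => hX k (by simp [hk])]
    simp

theorem foldl_update_add (l : List (Fin m)) (hl : l.Nodup) (X : Fin m → ℕ)
    (g : Option (Fin m) → ℕ) :
    l.foldl (fun g j => Function.update g (some j) (g (some j) + X j)) g =
      fun k => g k + k.elim 0 fun j => if j ∈ l then X j else 0 := by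
  induction l generalizing g with
  | nil => funext k; cases k <;> simp
  | cons j l ih =>
    rw [List.foldl_cons, ih hl.of_cons]
    have := (List.nodup_cons.1 hl).1
    funext k
    cases k with
    | none => simp
    | some k =>
      by_cases hk : k = j
      · subst hk; simp [this]
      · simp [hk]

theorem foldl_update_const {α β : Type} [DecidableEq α] (l : List α) (X : α → β) (g : α → β) :
    l.foldl (fun g j => Function.update g j (X j)) g = fun j => if j ∈ l then X j else g j := by
  induction l generalizing g with
  | nil => simp
  | cons j l ih =>
    rw [List.foldl_cons, ih]
    funext k
    by_cases hk : k = j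
    · subst hk; simp
    · simp [hk]

theorem exec_clearRegs (c : Ctl q m) (i r b h o : List Bool) (t : ℕ) (n : ℕ) (X : Fin m → ℕ)
    (hX : ∀ j, X j ≤ N) :
    exec N clearRegs (st c i r b h o t (counters n X)) =
      st c i r b h o t (counters n fun _ => 0) := by
  have := exec_seqs_map N (f := fun j => loop (pop (.reg (some j)) fun (v : Ctl q m) _ => v))
    (S := fun X => st c i r b h o t (counters n X)) (h := fun X j => Function.update X j 0)
    (fun X => ∀ j, X j ≤ N) (List.finRange m) (by
      intro j _ X hX
      constructor
      · rw [exec_clear_reg _ _ _ _ _ _ _ _ (hX j)]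
        congr
        funext k
        rcases k with _ | k
        · simp [counters]
        · by_cases hk : k = j
          · subst hk; simp [counters]
          · simp [counters, hk]
      · intro k
        by_cases hk : k = j
        · subst hk; simp
        · simp [hk, hX]) X hX
  rw [clearRegs, this, foldl_update_const _ (fun _ => 0)]
  simp

/-- The program for the relation matters only through its effect on marks, output and flag. Name,
looked-up marks and counters are reset, so the next constraint meets the same initial situation; the
constraint itself is kept in reverse on `rev` for later passes. -/
theorem exec_constraintStep {pos : Fin q → List (Fin m)} {P : Fin q → Prog (Stk m) (Ctl q m)}
    {n : ℕ} {c : RawConstraint q m} (hc : Readable pos N n c) (hpos : (pos c.1).Nodup)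
    {i r b b' o o' : List Bool} {fl fl' : Bool} (hb : b.length = n)
    (hP : ∀ i r, exec N (P c.1) (st ⟨none, false, c.1.castSucc, fl, scopeMarks pos b c⟩ i r b [] o 0
        (counters n c.2)) =
      st ⟨none, false, c.1.castSucc, fl', scopeMarks pos b c⟩ i r b' [] o' 0 (counters n c.2)) :
    exec N (constraintStep pos P) (st ⟨none, false, 0, fl, fun _ => false⟩ (rawCode pos c ++ i) r b
        [] o 0 (counters n fun _ => 0)) =
      st ⟨none, false, 0, fl', fun _ => false⟩ i ((rawCode pos c).reverse ++ r) b' [] o' 0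
        (counters n fun _ => 0) := by
  have hne : rawCode pos c ++ i ≠ [] := by simp [rawCode, encodeNats]
  obtain ⟨x, l, hl⟩ := List.exists_cons_of_ne_nil hne
  have h₁ := exec_readNat (N := N) fl (fun _ : Fin m => false)
    (encodeNats ((pos c.1).map c.2) ++ i) r o
    (load fun v : Ctl q m => { v with name := v.name + 1 }) id (fun _ => b)
    (fun _ => counters n fun _ => 0) (fun x => x + 1) (by simp) c.1 hc.name_lt 0
  have h₂ := iterate_eq_of_step (h := fun x : Fin (q + 1) => x + 1)
    (f := fun a => Fin.ofNat (q + 1) a) (fun a => Fin.ext (by simp [Fin.val_add])) c.1 0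
  have h₃ : Fin.ofNat (q + 1) (c.1 : ℕ) = c.1.castSucc :=
    Fin.ext (Nat.mod_eq_of_lt (by omega))
  have h₀ : Fin.ofNat (q + 1) 0 = 0 := rfl
  simp only [h₀, zero_add, h₃] at h₂
  simp only [h₂, id] at h₁
  have h₄ : (pos c.1).foldl (fun g j => Function.update g (some j) (g (some j) + c.2 j))
      (counters n fun _ => 0) = counters n c.2 := by
    rw [foldl_update_add _ hpos]
    funext k
    rcases k with _ | k
    · simp [counters]
    · by_cases hk : k ∈ pos c.1
      · simp [counters, hk]
      · simp [counters, hk, hc.eq_zero]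
  have h₅ (i r : List Bool) : exec N (seqs ((pos c.1).map lookup))
      (st ⟨none, false, c.1.castSucc, fl, fun _ => false⟩ i r b [] o 0 (counters n c.2)) =
      st ⟨none, false, c.1.castSucc, fl, scopeMarks pos b c⟩ i r b [] o 0 (counters n c.2) := by
    rw [exec_seqs_map N
      (S := fun bs => st ⟨none, false, c.1.castSucc, fl, bs⟩ i r b [] o 0 (counters n c.2))
      (h := fun bs j => Function.update bs j (b.getD (c.2 j) false)) (fun _ => True) (pos c.1)
      (fun j hj bs _ => ⟨exec_lookup _ _ _ _ _ _ _ _ j (by rw [hb]; exact hc.lt j hj)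
        (hc.var_le j), trivial⟩) _ trivial,
      foldl_update_const _ (fun j => b.getD (c.2 j) false)]
    rfl
  rw [constraintStep, hl]
  simp only [exec_seqs_cons, exec_pop_inp, exec_ite, List.head?_cons, Option.isSome_some, if_true,
    List.tail_cons, exec_push_inp, exec_load, Option.getD_some, exec_seqs_nil]
  rw [← hl, rawCode, encodeNats_cons, List.append_assoc, List.cons_append, h₁, exec_onName,
    exec_readRegs _ _ _ _ _ _ _ _ _ _ (fun j hj => hc.var_lt hj), h₄, exec_onName, h₅,
    exec_onName, hP, exec_clearRegs _ _ _ _ _ _ _ _ _ hc.var_le]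
  simp

/-- What the constraints in the list `L` do to the marks, the output and the flag. -/
theorem exec_pass {pos : Fin q → List (Fin m)} {P : Fin q → Prog (Stk m) (Ctl q m)} {n : ℕ}
    (hpos : ∀ i, (pos i).Nodup) (f : List Bool × List Bool × Bool → RawConstraint q m →
      List Bool × List Bool × Bool)
    (hP : ∀ c, Readable pos N n c → ∀ b o fl i r, b.length = n →
      exec N (P c.1) (st ⟨none, false, c.1.castSucc, fl, scopeMarks pos b c⟩ i r b [] o 0
        (counters n c.2)) =
      st ⟨none, false, c.1.castSucc, (f (b, o, fl) c).2.2, scopeMarks pos b c⟩ i r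
        (f (b, o, fl) c).1 [] (f (b, o, fl) c).2.1 0 (counters n c.2) ∧
      (f (b, o, fl) c).1.length = n)
    (L : List (RawConstraint q m)) (hL : ∀ c ∈ L, Readable pos N n c) (hN : L.length ≤ N)
    (r b o : List Bool) (fl : Bool) (hb : b.length = n) :
    exec N (loop (constraintStep pos P)) (st ⟨none, false, 0, fl, fun _ => false⟩
        (L.flatMap (rawCode pos)) r b [] o 0 (counters n fun _ => 0)) =
      st ⟨none, false, 0, (L.foldl f (b, o, fl)).2.2, fun _ => false⟩ []
        ((L.flatMap (rawCode pos)).reverse ++ r) (L.foldl f (b, o, fl)).1 []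
        (L.foldl f (b, o, fl)).2.1 0 (counters n fun _ => 0) := by
  have h₁ := iterate_list (F := exec N (constraintStep pos P))
    (S := fun L (s : List Bool × List Bool × List Bool × Bool) =>
      st ⟨none, false, 0, s.2.2.2, fun _ => false⟩
        (L.flatMap (rawCode pos)) s.1 s.2.1 [] s.2.2.1 0 (counters n fun _ => 0))
    (h := fun s c => ((rawCode pos c).reverse ++ s.1, f s.2 c))
    (fun L s => (∀ c ∈ L, Readable pos N n c) ∧ s.2.1.length = n) (by
      rintro c L ⟨r, b, o, fl⟩ ⟨hL, hb⟩
      have hc := hL c (by simp)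
      refine ⟨?_, fun d hd => hL d (by simp [hd]), (hP c hc b o fl [] [] hb).2⟩
      rw [List.flatMap_cons]
      exact exec_constraintStep hc (hpos _) hb fun i r => (hP c hc b o fl i r hb).1)
    (by simp [constraintStep]) L (r, b, o, fl) hN ⟨hL, hb⟩
  have h₂ (s : List Bool × List Bool × List Bool × Bool) :
      L.foldl (fun s c => ((rawCode pos c).reverse ++ s.1, f s.2 c)) s =
        ((L.flatMap (rawCode pos)).reverse ++ s.1, L.foldl f s.2) := by
    clear h₁ hL hN
    induction L generalizing s with
    | nil => simp
    | cons c L ih => simp [ih]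
  rw [h₂] at h₁
  simpa [exec_loop] using h₁

end Prog

end BoundedCSP

end

/-! ### The program of the reduction and its output -/

noncomputable section

namespace BoundedCSP

variable {q m : ℕ}

theorem foldl_encodeNats {α : Type} (f : α → ℕ) (p : α → Bool) (l : List α) (o : List Bool) :
    l.foldl (fun o x => if p x then o else encodeNats [f x] ++ o) o =
      encodeNats ((l.filter fun x => !p x).reverse.map f) ++ o := by
  induction l generalizing o with
  | nil => simp [encodeNats]
  | cons x l ih =>
    rw [List.foldl_cons, ih]
    cases h : p x <;> simp [h, encodeNats_append]

theorem replicate_add_append {α : Type} (a b : ℕ) (x : α) (l : List α) :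
    List.replicate (a + b) x ++ l = List.replicate a x ++ (List.replicate b x ++ l) := by
  rw [List.replicate_add, List.append_assoc]

/-- The number of unmarked positions of a clause is known only to the finite control. It is at most
the fixed length of the clause, so it can be written in unary by that many conditional pushes. -/
theorem foldl_range_lt (c k : ℕ) (o : List Bool) :
    (List.range k).foldl (fun o t => if t < c then true :: o else o) o =
      List.replicate (min c k) true ++ o := by
  induction k with
  | zero => simp
  | succ k ih =>
    rw [List.range_succ, List.foldl_append, ih]
    by_cases h : k < c
    · simp [h, min_eq_right h.le, List.replicate_succ]
    · simp [h, min_eq_left (not_lt.1 h), min_eq_left ((not_lt.1 h).trans k.le_succ)]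

/-- The effect on the marks of marking the variables in the positions `T i` of each constraint. -/
def marked (T : Fin q → List (Fin m)) (L : List (RawConstraint q m)) (b : List Bool) : List Bool :=
  L.foldl (fun b c => (T c.1).foldl (fun b j => b.set (c.2 j) true) b) b

/-- Whether all variables of some clause are marked. -/
def conflict (cls : Fin q → List (List (Fin m))) (L : List (RawConstraint q m))
    (b : List Bool) : Bool :=
  L.any fun c => (cls c.1).any fun C => C.all fun j => b.getD (c.2 j) false

/-- The hyper-edges for a constraint: the unmarked variables of each clause, and the singletons of
the variables that are marked because of the constraint. -/
def newEdges (ins : Fin q → List (Fin m)) (cls : Fin q → List (List (Fin m)))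
    (b : List Bool) (c : RawConstraint q m) : List (List ℕ) :=
  ((cls c.1).reverse.map fun C =>
    (C.filter fun j => !b.getD (c.2 j) false).reverse.map c.2) ++
    (ins c.1).reverse.map fun j => [c.2 j]

/-- The hyper-edges on `w` new vertices: all of them, and the singletons. -/
def freshEdges (n w : ℕ) : List (List ℕ) :=
  (List.range w).reverse.map (n + ·) :: (List.range w).reverse.map fun a => [n + a]

theorem length_foldl_set {α : Type} (l : List α) (f : α → ℕ) (b : List Bool) :
    (l.foldl (fun b j => b.set (f j) true) b).length = b.length := by
  induction l generalizing b with
  | nil => rfl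
  | cons x l ih => simp [ih]

theorem length_marked (T : Fin q → List (Fin m)) (L : List (RawConstraint q m)) (b : List Bool) :
    (marked T L b).length = b.length := by
  induction L generalizing b with
  | nil => rfl
  | cons c L ih =>
    rw [marked, List.foldl_cons]
    exact (ih _).trans (length_foldl_set _ _ _)

namespace Prog

/-- Write `a` letters `1`. -/
def pushes (a : ℕ) : Prog (Stk m) (Ctl q m) :=
  seqs ((List.range a).map fun _ => push .out fun _ => true)

def pushNat (a : ℕ) : Prog (Stk m) (Ctl q m) := seqs [push .out fun _ => false, pushes a]

/-- Write the number of variables plus `a`. -/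
def emitFresh (a : ℕ) : Prog (Stk m) (Ctl q m) := seqs [emit none, pushes a]

/-- Write the hyper-edge of the unmarked variables in the positions `D`. -/
def emitEdge (D : List (Fin m)) : Prog (Stk m) (Ctl q m) :=
  seqs [seqs (D.map fun j => ite (fun v => v.bits j) skip (emit (some j))),
    push .out fun _ => false,
    seqs ((List.range D.length).map fun t =>
      ite (fun v => decide (t < (D.filter fun j => !v.bits j).length)) (push .out fun _ => true)
        skip)]

def emitSingle (j : Option (Fin m)) (a : ℕ) : Prog (Stk m) (Ctl q m) :=
  seqs [emit j, pushes a, pushNat 1]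

def emitEdges (ins : Fin q → List (Fin m)) (cls : Fin q → List (List (Fin m))) (i : Fin q) :
    Prog (Stk m) (Ctl q m) :=
  seqs [seqs ((ins i).map fun j => emitSingle (some j) 0), seqs ((cls i).map emitEdge)]

def checkClauses (cls : Fin q → List (List (Fin m))) (i : Fin q) : Prog (Stk m) (Ctl q m) :=
  seqs ((cls i).map fun C => ite (fun v => C.all v.bits) (load fun v => { v with fail := true })
    skip)

def markAll (T : Fin q → List (Fin m)) (i : Fin q) : Prog (Stk m) (Ctl q m) :=
  seqs ((T i).map mark)

/-- Being written last and backwards, this is the front of the code: the number of vertices, then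
the hyper-edge of all new vertices, then their singletons. -/
def emitTail (w : ℕ) : Prog (Stk m) (Ctl q m) :=
  seqs [seqs ((List.range w).map fun a => emitSingle none a),
    seqs ((List.range w).map emitFresh), pushNat w, emitFresh w]

/-- Read the number of variables, and set up the list of marks. -/
def header : Prog (Stk m) (Ctl q m) :=
  seqs [readNat (seqs [push (.reg none) fun _ => true, push .bad fun _ => false]),
    -- The number of variables is discarded here, so that later rewinding restores the constraints
    -- alone.
    loop (pop .rev fun v _ => v)]

/-- Write the power of two whose exponent is the number of unmarked variables. -/
def countUnmarked : Prog (Stk m) (Ctl q m) :=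
  seqs [push .out fun _ => true,
    loop (whenPop .bad (ite (fun v => v.bit.getD false) skip (push .out fun _ => false)))]

/-- The reduction: mark the variables that are forced to take the distinguished value, look for
a contradiction, and then write either the number of solutions or a hypergraph. -/
def reduction (pos ins : Fin q → List (Fin m)) (cls : Fin q → List (List (Fin m))) (w : ℕ) :
    Prog (Stk m) (Ctl q m) :=
  seqs [rewind, header, loop (constraintStep pos (markAll ins)), rewind,
    loop (constraintStep pos (checkClauses cls)), rewind,
    -- After a contradiction the output stack stays empty, and the empty string represents 0.
    ite (fun v => v.fail) skip
      -- The width is fixed, so this is a choice between two programs and not a test made by the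
      -- machine.
      (if w = 0 then
        seqs [loop (constraintStep pos (markAll fun i => (cls i).flatten)), countUnmarked]
      else seqs [loop (constraintStep pos (emitEdges ins cls)), emitTail w])]

variable {N : ℕ} (nm : Fin (q + 1)) (fl : Bool) (bs : Fin m → Bool) (i r b o : List Bool)
  (g : Option (Fin m) → ℕ)

theorem exec_pushes (a : ℕ) (c : Ctl q m) (h : List Bool) (t : ℕ) :
    exec N (pushes a) (st c i r b h o t g) =
      st c i r b h (List.replicate a true ++ o) t g := by
  rw [pushes, exec_seqs_map N (S := fun o => st c i r b h o t g) (h := fun o _ => true :: o)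
    (fun _ => True) _ (by simp) o trivial]
  congr
  induction a generalizing o with
  | zero => simp
  | succ a ih => rw [List.range_succ, List.foldl_append, ih]; simp [List.replicate_succ]

theorem exec_pushNat (a : ℕ) (c : Ctl q m) (h : List Bool) (t : ℕ) :
    exec N (pushNat a) (st c i r b h o t g) =
      st c i r b h (encodeNats [a] ++ o) t g := by
  simp [pushNat, exec_pushes, encodeNats]

theorem exec_emitFresh (a : ℕ) (hg : g none ≤ N) :
    exec N (emitFresh a) (st ⟨none, false, nm, fl, bs⟩ i r b [] o 0 g) =
      st ⟨none, false, nm, fl, bs⟩ i r b [] (encodeNats [g none + a] ++ o) 0 g := by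
  simp [emitFresh, exec_pushes, exec_emit, hg, encodeNats, Nat.add_comm _ a,
    replicate_add_append]

theorem exec_emitSingle (j : Option (Fin m)) (a : ℕ) (hg : g j ≤ N) :
    exec N (emitSingle j a) (st ⟨none, false, nm, fl, bs⟩ i r b [] o 0 g) =
      st ⟨none, false, nm, fl, bs⟩ i r b [] (encodeEdges [[g j + a]] ++ o) 0 g := by
  simp [emitSingle, exec_pushes, exec_pushNat, exec_emit, hg, encodeNats, Nat.add_comm _ a,
    replicate_add_append, encodeEdges]

theorem exec_emitEdge (D : List (Fin m)) (hg : ∀ j, g (some j) ≤ N) :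
    exec N (emitEdge D) (st ⟨none, false, nm, fl, bs⟩ i r b [] o 0 g) =
      st ⟨none, false, nm, fl, bs⟩ i r b []
        (encodeEdges [(D.filter fun j => !bs j).reverse.map fun j => g (some j)] ++ o) 0 g := by
  simp only [emitEdge, exec_seqs_cons, exec_seqs_nil]
  rw [exec_seqs_map N (S := fun o => st ⟨none, false, nm, fl, bs⟩ i r b [] o 0 g)
    (h := fun o j => if bs j then o else encodeNats [g (some j)] ++ o) (fun _ => True) D
    (fun j _ o _ => ⟨by
      rw [exec_ite, exec_skip, exec_emit _ _ _ _ _ _ _ _ _ _ (hg j)]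
      split <;> rfl, trivial⟩) o trivial, foldl_encodeNats, exec_push_out,
    exec_seqs_map N (S := fun o => st ⟨none, false, nm, fl, bs⟩ i r b [] o 0 g)
    (h := fun o t => if t < (D.filter fun j => !bs j).length then true :: o else o)
    (fun _ => True) _ (fun j _ o _ => ⟨by
      rw [exec_ite, exec_skip, exec_push_out]
      simp only [decide_eq_true_eq]
      split <;> rfl, trivial⟩) _ trivial, foldl_range_lt,
    min_eq_left (List.length_filter_le _ _)]
  simp [encodeEdges, encodeNats_cons]

theorem exec_emitEdges {pos ins : Fin q → List (Fin m)} {cls : Fin q → List (List (Fin m))}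
    (hcls : ∀ i, ∀ C ∈ cls i, C ⊆ pos i) {n : ℕ} {c : RawConstraint q m}
    (hc : Readable pos N n c) :
    exec N (emitEdges ins cls c.1) (st ⟨none, false, nm, fl, scopeMarks pos b c⟩ i r b [] o 0
        (counters n c.2)) =
      st ⟨none, false, nm, fl, scopeMarks pos b c⟩ i r b []
        (encodeEdges (newEdges ins cls b c) ++ o) 0 (counters n c.2) := by
  simp only [emitEdges, exec_seqs_cons, exec_seqs_nil]
  rw [exec_seqs_map N
    (S := fun o => st ⟨none, false, nm, fl, scopeMarks pos b c⟩ i r b [] o 0 (counters n c.2))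
    (h := fun o j => encodeEdges [[c.2 j]] ++ o) (fun _ => True) _
    (fun j _ o _ => ⟨exec_emitSingle _ _ _ _ _ _ _ _ _ _ (hc.var_le j), trivial⟩) o trivial,
    foldl_encodeEdges,
    exec_seqs_map N
    (S := fun o => st ⟨none, false, nm, fl, scopeMarks pos b c⟩ i r b [] o 0 (counters n c.2))
    (h := fun o C => encodeEdges [(C.filter fun j => !b.getD (c.2 j) false).reverse.map c.2] ++ o)
    (fun _ => True) _ (fun C hC o _ => ⟨by
      rw [exec_emitEdge _ _ _ _ _ _ _ _ _ hc.var_le]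
      -- The positions in a clause belong to the scope, so their marks have been looked up.
      have : (C.filter fun j => !scopeMarks pos b c j) =
          C.filter fun j => !b.getD (c.2 j) false :=
        List.filter_congr fun j hj => by simp [scopeMarks, hcls _ C hC hj]
      rw [this]
      rfl, trivial⟩) _ trivial, foldl_encodeEdges]
  simp [newEdges, encodeEdges_append, List.map_eq_flatMap]

theorem exec_checkClauses {pos : Fin q → List (Fin m)} {cls : Fin q → List (List (Fin m))}
    (hcls : ∀ i, ∀ C ∈ cls i, C ⊆ pos i) {n : ℕ} {c : RawConstraint q m} :
    exec N (checkClauses cls c.1) (st ⟨none, false, nm, fl, scopeMarks pos b c⟩ i r b [] o 0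
        (counters n c.2)) =
      st ⟨none, false, nm, fl || (cls c.1).any fun C => C.all fun j => b.getD (c.2 j) false,
        scopeMarks pos b c⟩ i r b [] o 0 (counters n c.2) := by
  rw [checkClauses, exec_seqs_map N
    (S := fun fl => st ⟨none, false, nm, fl, scopeMarks pos b c⟩ i r b [] o 0 (counters n c.2))
    (h := fun fl C => fl || C.all fun j => b.getD (c.2 j) false)
    (fun _ => True) _ (fun C hC fl _ => ⟨by
      have : C.all (scopeMarks pos b c) = C.all fun j => b.getD (c.2 j) false := by
        rw [Bool.eq_iff_iff, List.all_eq_true, List.all_eq_true]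
        exact forall₂_congr fun j hj => by simp [scopeMarks, hcls _ C hC hj]
      rw [exec_ite, exec_skip, exec_load, this]
      cases C.all fun j => b.getD (c.2 j) false <;> simp, trivial⟩) _ trivial]
  congr 2
  generalize cls c.1 = l
  induction l generalizing fl with
  | nil => simp
  | cons C l ih => rw [List.foldl_cons, ih]; simp [Bool.or_assoc]

theorem exec_markAll {pos T : Fin q → List (Fin m)} (hT : ∀ i, T i ⊆ pos i) {n : ℕ}
    {c : RawConstraint q m} (hc : Readable pos N n c) (hb : b.length = n) :
    exec N (markAll T c.1) (st ⟨none, false, nm, fl, bs⟩ i r b [] o 0 (counters n c.2)) =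
      st ⟨none, false, nm, fl, bs⟩ i r ((T c.1).foldl (fun b j => b.set (c.2 j) true) b) [] o 0
        (counters n c.2) := by
  rw [markAll, exec_seqs_map N
    (S := fun b => st ⟨none, false, nm, fl, bs⟩ i r b [] o 0 (counters n c.2))
    (h := fun b j => b.set (c.2 j) true) (fun b => b.length = n) _ (fun j hj b hb =>
      ⟨exec_mark _ _ _ _ _ _ _ _ j (by rw [hb]; exact hc.lt j (hT _ hj)) (hc.var_le j),
        by simpa using hb⟩) b hb]

theorem exec_emitTail (n w : ℕ) (hn : g none = n) (hN : n ≤ N) :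
    exec N (emitTail w) (st ⟨none, false, nm, fl, bs⟩ i r b [] o 0 g) =
      st ⟨none, false, nm, fl, bs⟩ i r b []
        (encodeNats [n + w] ++ encodeEdges (freshEdges n w) ++ o) 0 g := by
  subst hn
  simp only [emitTail, exec_seqs_cons, exec_seqs_nil]
  rw [exec_seqs_map N
    (S := fun o => st ⟨none, false, nm, fl, bs⟩ i r b [] o 0 g)
    (h := fun o a => encodeEdges [[g none + a]] ++ o) (fun _ => True) _
    (fun j _ o _ => ⟨exec_emitSingle _ _ _ _ _ _ _ _ _ _ hN, trivial⟩) o trivial,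
    foldl_encodeEdges,
    exec_seqs_map N
    (S := fun o => st ⟨none, false, nm, fl, bs⟩ i r b [] o 0 g)
    (h := fun o a => if (fun _ => false : ℕ → Bool) a then o else encodeNats [g none + a] ++ o)
    (fun _ => True) _
    (fun j _ o _ => ⟨exec_emitFresh _ _ _ _ _ _ _ _ _ hN, trivial⟩) _ trivial,
    foldl_encodeNats, exec_pushNat, exec_emitFresh _ _ _ _ _ _ _ _ _ hN, ← List.map_eq_flatMap]
  simp [freshEdges, encodeEdges, encodeNats_nil, encodeNats_append, encodeNats_cons]

theorem exec_header (n : ℕ) (hn : n + 1 ≤ N) :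
    exec N header (st ⟨none, false, nm, fl, bs⟩ (List.replicate n true ++ false :: i) [] [] [] o 0
        (counters 0 fun _ => 0)) =
      st ⟨none, false, nm, fl, bs⟩ i [] (List.replicate n false) [] o 0
        (counters n fun _ => 0) := by
  have h₁ := exec_readNat (N := N) fl bs i [] o
    (seqs [push (.reg none) fun _ => true, push .bad fun _ => false]) (fun _ => nm)
    (fun a => List.replicate a false) (fun a => counters a fun _ => 0) (fun a => a + 1)
    (by
      intro a i r
      simp only [exec_seqs_cons, exec_seqs_nil, exec_push_reg, exec_push_bad, List.replicate_succ]
      congr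
      funext k
      rcases k with _ | k <;> simp [counters]) n hn 0
  have h₂ := iterate_eq_of_step (h := fun a : ℕ => a + 1) (f := id) (by simp) n 0
  simp only [id, zero_add] at h₂
  rw [h₂] at h₁
  simp only [header, exec_seqs_cons, exec_seqs_nil]
  refine (congrArg _ h₁).trans ?_
  exact exec_clear_rev _ _ _ _ _ _ _ (by simpa using hn) _

theorem exec_countUnmarked (hb : b.length ≤ N) :
    exec N countUnmarked (st ⟨none, false, nm, fl, bs⟩ i r b [] o 0 g) =
      st ⟨none, false, nm, fl, bs⟩ i r [] [] (List.replicate (b.count false) false ++ true :: o)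
        0 g := by
  have h₁ := iterate_list
    (F := exec N (whenPop .bad (ite (fun v => v.bit.getD false) skip (push .out fun _ => false))))
    (S := fun b o => st ⟨none, false, nm, fl, bs⟩ i r b [] o 0 g)
    (h := fun o x => if x then o else false :: o) (fun _ _ => True)
    (by rintro (_ | _) l o - <;> simp [whenPop]) (by simp [whenPop]) b (true :: o) hb trivial
  have h₂ (o : List Bool) : b.foldl (fun o x => if x then o else false :: o) o =
      List.replicate (b.count false) false ++ o := by
    clear h₁ hb
    induction b generalizing o with
    | nil => simp
    | cons x b ih => cases x <;> simp [ih, List.replicate_succ']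
  rw [h₂] at h₁
  simpa [countUnmarked, exec_loop] using h₁

end Prog

/-- The internal state at the beginning. -/
def startCtl : Ctl q m := ⟨none, false, 0, false, fun _ => false⟩

theorem rawCode_length_pos (pos : Fin q → List (Fin m)) (c : RawConstraint q m) :
    1 ≤ (rawCode pos c).length := by
  rw [rawCode, length_encodeNats_cons]; omega

/-- The outcome of the reduction. -/
theorem result_reduction {pos ins : Fin q → List (Fin m)} {cls : Fin q → List (List (Fin m))}
    (hpos : ∀ i, (pos i).Nodup) (hins : ∀ i, ins i ⊆ pos i)
    (hcls : ∀ i, ∀ C ∈ cls i, C ⊆ pos i) (w n : ℕ) (L : List (RawConstraint q m))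
    (hlt : ∀ c ∈ L, ∀ j ∈ pos c.1, c.2 j < n) (hzero : ∀ c ∈ L, ∀ j ∉ pos c.1, c.2 j = 0) :
    ((Prog.reduction pos ins cls w).result .rev startCtl
      (encodeNats (n :: L.flatMap fun c => (c.1 : ℕ) :: (pos c.1).map c.2))).1.fail =
        conflict cls L (marked ins L (List.replicate n false)) ∧
    ((Prog.reduction pos ins cls w).result .rev startCtl
      (encodeNats (n :: L.flatMap fun c => (c.1 : ℕ) :: (pos c.1).map c.2))).2 .out =
      if conflict cls L (marked ins L (List.replicate n false)) then [] else
        if w = 0 then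
          List.replicate ((marked (fun i => (cls i).flatten) L
            (marked ins L (List.replicate n false))).count false) false ++ [true]
        else encodeNats ((n + w) :: (freshEdges n w ++
          L.reverse.flatMap (newEdges ins cls (marked ins L (List.replicate n false)))).flatMap
            fun l => l.length :: l) := by
  have hcode : encodeNats (n :: L.flatMap fun c => (c.1 : ℕ) :: (pos c.1).map c.2) =
      List.replicate n true ++ false :: L.flatMap (rawCode pos) := by
    rw [encodeNats_cons]
    congr 2
    clear hlt hzero
    induction L with
    | nil => simp [encodeNats]
    | cons c L ih => rw [List.flatMap_cons, List.flatMap_cons, ← ih, encodeNats_append, rawCode]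
  rw [hcode]
  set s := List.replicate n true ++ false :: L.flatMap (rawCode pos) with hs
  set N := s.length with hN
  -- Everything that a loop has to run through is part of the input, so `N` iterations suffice
  -- everywhere.
  have hlen : n + 1 + (L.flatMap (rawCode pos)).length = N := by simp [hN, hs]; omega
  have hread : ∀ c ∈ L, Readable pos N n c := fun c hc => ⟨hlt c hc, hzero c hc, by
    have : (rawCode pos c).length ≤ (L.flatMap (rawCode pos)).length :=
      (List.sublist_flatten_of_mem (List.mem_map_of_mem hc)).length_le
    omega⟩
  have hLN : L.length ≤ N := by
    have : L.length ≤ (L.flatMap (rawCode pos)).length := by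
      clear hread hlen hN hs hcode hlt hzero
      induction L with
      | nil => simp
      | cons c L ih =>
        have := rawCode_length_pos pos c
        simp only [List.flatMap_cons, List.length_append, List.length_cons]
        omega
    omega
  set b₀ := marked ins L (List.replicate n false) with hb₀
  have hb₀n : b₀.length = n := by simp [hb₀, length_marked]
  have hstart : (startCtl, Function.update (fun _ : Stk m => []) .rev s.reverse) =
      st (q := q) startCtl [] s.reverse [] [] [] 0 (counters 0 fun _ => 0) := by
    refine Prod.ext rfl (funext fun k => ?_)
    rcases k with _ | _ | _ | _ | _ | _ | (_ | _) <;> simp [st, counters]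
  -- `exec_pass` describes a pass as a fold over triples of marks, output and flag. Here and below
  -- the fold is reduced to the one component that the pass changes.
  have markFold (T : Fin q → List (Fin m)) (b o : List Bool) (fl : Bool) :
      L.foldl (fun (x : List Bool × List Bool × Bool) c =>
        ((T c.1).foldl (fun b j => b.set (c.2 j) true) x.1, x.2)) (b, o, fl) =
      (marked T L b, o, fl) := by
    clear_value b₀ s
    clear hstart hb₀n hb₀ hread hlen hcode hlt hzero hLN hs
    induction L generalizing b with
    | nil => rfl
    | cons c L ih => simp [ih, marked]
  have mark (T : Fin q → List (Fin m)) (hT : ∀ i, T i ⊆ pos i) (b : List Bool)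
      (hb : b.length = n) :=
    Prog.exec_pass (N := N) hpos (fun x c =>
      ((T c.1).foldl (fun b j => b.set (c.2 j) true) x.1, x.2))
      (P := Prog.markAll T) (fun c hc b o fl i r hb =>
        ⟨Prog.exec_markAll _ _ _ _ _ _ _ hT hc hb, (length_foldl_set _ _ _).trans hb⟩)
      L hread hLN [] b [] false hb
  have checkFold (b o : List Bool) (fl : Bool) :
      L.foldl (fun (x : List Bool × List Bool × Bool) c => (x.1, x.2.1, x.2.2 ||
        (cls c.1).any fun C => C.all fun j => x.1.getD (c.2 j) false)) (b, o, fl) =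
      (b, o, fl || conflict cls L b) := by
    clear_value b₀ s
    clear hstart hb₀n hb₀ hread hlen hcode hlt hzero hLN hs mark markFold
    induction L generalizing fl with
    | nil => simp [conflict]
    | cons c L ih => rw [List.foldl_cons, ih]; simp [conflict, Bool.or_assoc]
  have check := Prog.exec_pass (N := N) hpos (fun x c => (x.1, x.2.1, x.2.2 ||
        (cls c.1).any fun C => C.all fun j => x.1.getD (c.2 j) false))
      (P := Prog.checkClauses cls) (fun c hc b o fl i r hb =>
        ⟨Prog.exec_checkClauses _ _ _ _ _ _ hcls, hb⟩)
      L hread hLN [] b₀ [] false hb₀n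
  have emitFold (b o : List Bool) (fl : Bool) :
      L.foldl (fun (x : List Bool × List Bool × Bool) c =>
        (x.1, encodeEdges (newEdges ins cls x.1 c) ++ x.2.1, x.2.2)) (b, o, fl) =
      (b, encodeEdges (L.reverse.flatMap (newEdges ins cls b)) ++ o, fl) := by
    rw [← foldl_encodeEdges]
    clear_value b₀ s
    clear hstart hb₀n hb₀ hread hlen hcode hlt hzero hLN hs mark markFold check checkFold
    induction L generalizing o with
    | nil => rfl
    | cons c L ih => rw [List.foldl_cons, ih, List.foldl_cons]
  have emit := Prog.exec_pass (N := N) hpos (fun x c =>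
        (x.1, encodeEdges (newEdges ins cls x.1 c) ++ x.2.1, x.2.2))
      (P := Prog.emitEdges ins cls) (fun c hc b o fl i r hb =>
        ⟨Prog.exec_emitEdges _ _ _ _ _ _ hcls hc, hb⟩)
      L hread hLN [] b₀ [] false hb₀n
  simp only [markFold] at mark
  rw [checkFold] at check
  rw [emitFold] at emit
  have rew (fl : Bool) (b : List Bool) := Prog.exec_rewind (N := N) (0 : Fin (q + 1)) fl
    (fun _ : Fin m => false) [] ((L.flatMap (rawCode pos)).reverse) b [] [] 0
    (counters n fun _ => 0) (by rw [List.length_reverse]; omega)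
  simp only [List.reverse_reverse, List.append_nil] at rew mark check emit
  have hres (p : Prog (Stk m) (Ctl q m)) : p.result .rev startCtl s =
      p.exec N (st startCtl [] s.reverse [] [] [] 0 (counters 0 fun _ => 0)) := by
    rw [← hstart]; rfl
  rw [hres, Prog.reduction, startCtl]
  simp only [Prog.exec_seqs_cons, Prog.exec_seqs_nil]
  rw [Prog.exec_rewind _ _ _ _ _ _ _ _ _ _ (by simp [hN]), List.reverse_reverse, List.append_nil,
    hs, Prog.exec_header _ _ _ _ _ _ (by omega), mark ins hins _ (by simp), ← hb₀, rew, check, rew,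
    Bool.false_or, Prog.exec_ite]
  cases conflict cls L b₀ with
  | true => simp [st]
  | false =>
    by_cases hw : w = 0
    · simp only [hw, Bool.false_eq_true, if_false, if_true, Prog.exec_seqs_cons,
        Prog.exec_seqs_nil]
      rw [mark _ (fun i j hj => by
        obtain ⟨C, hC, hj⟩ := List.mem_flatten.1 hj
        exact hcls i C hC hj) b₀ hb₀n, Prog.exec_countUnmarked _ _ _ _ _ _ _ _
          (by rw [length_marked]; omega)]
      simp [st]
    · simp only [hw, Bool.false_eq_true, if_false, Prog.exec_seqs_cons,
        Prog.exec_seqs_nil]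
      rw [emit, Prog.exec_emitTail _ _ _ _ _ _ _ _ n w rfl (by omega)]
      simp [st, encodeNats_cons, encodeNats_nil, encodeEdges, encodeNats_append]

end BoundedCSP

end

noncomputable section

namespace BoundedCSP

/-! ### The hypergraph of an instance -/

variable {Γ : ConstraintLanguage}

namespace CSPInstance

variable (I : CSPInstance Γ) (ins : ∀ i : Fin Γ.length, List (Fin (Γ.get i).arity))
  (cls : ∀ i : Fin Γ.length, List (List (Fin (Γ.get i).arity))) (w : ℕ)

/-- The variable `u` is forced to take the distinguished value. -/
def Forced (u : Fin I.numVars) : Prop := ∃ c ∈ I.constraints, ∃ j ∈ ins c.1, c.2 j = u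

/-- The hyper-edge for the clause `C` of the constraint `c`. -/
def clauseEdge (c : Constraint Γ (Fin I.numVars)) (C : List (Fin (Γ.get c.1).arity)) :
    Set (Fin (I.numVars + w)) :=
  {x | ∃ j ∈ C, ¬ I.Forced ins (c.2 j) ∧ x = Fin.castAdd w (c.2 j)}

/-- The hyper-edge of all new vertices realizes the width, and their singletons make these vertices
irrelevant for the count. The singletons of forced variables prevent such variables from
contributing factors of two. -/
def IsEdge (e : Set (Fin (I.numVars + w))) : Prop :=
  e = Set.range (Fin.natAdd I.numVars) ∨ (∃ a, e = {Fin.natAdd I.numVars a}) ∨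
    (∃ c ∈ I.constraints, ∃ j ∈ ins c.1, e = {Fin.castAdd w (c.2 j)}) ∨
    ∃ c ∈ I.constraints, ∃ C ∈ cls c.1, e = I.clauseEdge ins w c C

/-- Some clause has only forced variables. -/
def Conflict : Prop :=
  ∃ c ∈ I.constraints, ∃ C ∈ cls c.1, ∀ j ∈ C, I.Forced ins (c.2 j)

variable {I ins cls w} {v : Bool}
  (hdef : ∀ i (a : Fin (Γ.get i).arity → Bool), a ∈ (Γ.get i).tuples ↔
    (∀ j ∈ ins i, a j = v) ∧ ∀ C ∈ cls i, ∃ j ∈ C, a j ≠ v)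

include hdef

theorem satisfies_iff (s : Fin I.numVars → Bool) :
    I.Satisfies s ↔ (∀ u, I.Forced ins u → s u = v) ∧
      ∀ c ∈ I.constraints, ∀ C ∈ cls c.1, ∃ j ∈ C, s (c.2 j) ≠ v := by
  simp only [Satisfies, hdef, Forced]
  constructor
  · intro h
    refine ⟨?_, fun c hc => (h c hc).2⟩
    rintro u ⟨c, hc, j, hj, rfl⟩
    exact (h c hc).1 j hj
  · exact fun h c hc => ⟨fun j hj => h.1 _ ⟨c, hc, j, hj, rfl⟩, h.2 c hc⟩

theorem Z_eq_zero (hI : I.Conflict ins cls) : I.Z = 0 := by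
  rw [Z, Set.ncard_eq_zero]
  refine Set.eq_empty_of_forall_notMem fun s hs => ?_
  obtain ⟨h₁, h₂⟩ := (satisfies_iff hdef s).1 hs
  obtain ⟨c, hc, C, hC, h⟩ := hI
  obtain ⟨j, hj, hne⟩ := h₂ c hc C hC
  exact hne (h₁ _ (h j hj))

open scoped Classical in
-- If all clauses have one argument, the constraints restrict each variable separately, and the
-- satisfying assignments form a product of sets with one or two elements.
theorem Z_eq_two_pow (hI : ¬ I.Conflict ins cls) (hcls : ∀ i, ∀ C ∈ cls i, ∃ j, C = [j]) :
    I.Z = 2 ^ (Finset.univ.filter fun u => ¬ (I.Forced ins u ∨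
      I.Forced (fun i => (cls i).flatten) u)).card := by
  -- A variable forced to both values would turn its one-argument clause into a conflict.
  have h₁ (u) (hu : I.Forced ins u) (hu' : I.Forced (fun i => (cls i).flatten) u) : False := by
    obtain ⟨c, hc, j, hj, rfl⟩ := hu'
    obtain ⟨C, hC, hj⟩ := List.mem_flatten.1 hj
    obtain ⟨k, rfl⟩ := hcls _ C hC
    obtain rfl := List.mem_singleton.1 hj
    exact hI ⟨c, hc, _, hC, by simpa using hu⟩
  let A (u : Fin I.numVars) : Finset Bool :=
    if I.Forced ins u then {v} else
      if I.Forced (fun i => (cls i).flatten) u then {!v} else Finset.univ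
  have h₂ : {s | I.Satisfies s} = (Fintype.piFinset A : Finset (Fin I.numVars → Bool)) := by
    ext s
    simp only [Set.mem_ofPred_eq, Finset.mem_coe, Fintype.mem_piFinset, satisfies_iff hdef]
    constructor
    · rintro ⟨hs, hs'⟩ u
      by_cases hu : I.Forced ins u
      · simp [A, hu, hs u hu]
      · by_cases hu' : I.Forced (fun i => (cls i).flatten) u
        · obtain ⟨c, hc, j, hj, rfl⟩ := id hu'
          obtain ⟨C, hC, hj⟩ := List.mem_flatten.1 hj
          obtain ⟨k, rfl⟩ := hcls _ C hC
          obtain rfl := List.mem_singleton.1 hj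
          simpa [A, hu, hu', Bool.eq_not_iff] using hs' c hc _ hC
        · simp [A, hu, hu']
    · intro hs
      refine ⟨fun u hu => by simpa [A, hu] using hs u, fun c hc C hC => ?_⟩
      obtain ⟨j, rfl⟩ := hcls _ C hC
      have hu : I.Forced (fun i => (cls i).flatten) (c.2 j) :=
        ⟨c, hc, j, List.mem_flatten.2 ⟨_, hC, by simp⟩, rfl⟩
      refine ⟨j, by simp, ?_⟩
      have := hs (c.2 j)
      simp only [A, hu, if_neg (fun h => h₁ _ h hu), if_true, Finset.mem_singleton] at this
      simp [this]
  rw [Z, h₂, Set.ncard_coe_finset, Fintype.card_piFinset, Finset.card_filter,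
    ← Finset.prod_pow_eq_pow_sum]
  refine Finset.prod_congr rfl fun u _ => ?_
  by_cases hu : I.Forced ins u
  · simp [A, hu]
  · by_cases hu' : I.Forced (fun i => (cls i).flatten) u <;> simp [A, hu, hu']

/-- The bijection sends `s` to the set of unforced variables with value `v`. Nothing is lost by
omitting the forced ones, as their value is known; and a clause is satisfied exactly if one of its
unforced variables lies outside of this set. -/
theorem Z_eq_ncard (hw : w ≠ 0) :
    I.Z = Set.ncard {S : Set (Fin (I.numVars + w)) | ∀ e, I.IsEdge ins cls w e → ¬ e ⊆ S} := by
  classical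
  have hind (S : Set (Fin (I.numVars + w))) : (∀ e, I.IsEdge ins cls w e → ¬ e ⊆ S) ↔
      (∀ a, Fin.natAdd I.numVars a ∉ S) ∧ (∀ u, I.Forced ins u → Fin.castAdd w u ∉ S) ∧
      ∀ c ∈ I.constraints, ∀ C ∈ cls c.1,
        ∃ j ∈ C, ¬ I.Forced ins (c.2 j) ∧ Fin.castAdd w (c.2 j) ∉ S := by
    constructor
    · intro h
      refine ⟨fun a ha => h _ (.inr (.inl ⟨a, rfl⟩)) (by simpa using ha), ?_, ?_⟩
      · rintro u ⟨c, hc, j, hj, rfl⟩ hu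
        exact h _ (.inr (.inr (.inl ⟨c, hc, j, hj, rfl⟩))) (by simpa using hu)
      · intro c hc C hC
        obtain ⟨x, ⟨j, hj, hf, rfl⟩, hx⟩ :=
          Set.not_subset.1 (h _ (.inr (.inr (.inr ⟨c, hc, C, hC, rfl⟩))))
        exact ⟨j, hj, hf, hx⟩
    · rintro ⟨h₁, h₂, h₃⟩ e (rfl | ⟨a, rfl⟩ | ⟨c, hc, j, hj, rfl⟩ | ⟨c, hc, C, hC, rfl⟩) he
      -- For `w = 0` this hyper-edge would be empty and no set would be independent.
      · exact h₁ ⟨0, Nat.pos_of_ne_zero hw⟩ (he ⟨_, rfl⟩)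
      · exact h₁ a (he rfl)
      · exact h₂ _ ⟨c, hc, j, hj, rfl⟩ (he rfl)
      · obtain ⟨j, hj, hf, hS⟩ := h₃ c hc C hC
        exact hS (he ⟨j, hj, hf, rfl⟩)
  simp only [Z, hind, satisfies_iff hdef]
  have hne (a : Fin w) (u : Fin I.numVars) : Fin.natAdd I.numVars a ≠ Fin.castAdd w u := by
    intro h
    have := congrArg Fin.val h
    simp at this
    omega
  refine Set.ncard_congr
    (fun s _ => {x | ∃ u, x = Fin.castAdd w u ∧ ¬ I.Forced ins u ∧ s u = v}) ?_ ?_ ?_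
  · rintro s ⟨h₁, h₂⟩
    refine ⟨?_, ?_, ?_⟩
    · rintro a ⟨u, hu, -⟩
      exact hne _ _ hu
    · rintro u hu ⟨u', hu', hf, -⟩
      obtain rfl := Fin.castAdd_injective _ _ hu'
      exact hf hu
    · intro c hc C hC
      obtain ⟨j, hj, hs⟩ := h₂ c hc C hC
      refine ⟨j, hj, fun hf => hs (h₁ _ hf), ?_⟩
      rintro ⟨u', hu', -, hs'⟩
      rw [← Fin.castAdd_injective _ _ hu'] at hs'
      exact hs hs'
  · rintro s s' ⟨h₁, -⟩ ⟨h₁', -⟩ h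
    funext u
    by_cases hu : I.Forced ins u
    · rw [h₁ u hu, h₁' u hu]
    · have key (t : Fin I.numVars → Bool) : Fin.castAdd w u ∈
          {x : Fin (I.numVars + w) | ∃ u, x = Fin.castAdd w u ∧ ¬ I.Forced ins u ∧ t u = v} ↔
            t u = v := by
        constructor
        · rintro ⟨u', hu', -, ht⟩
          rwa [Fin.castAdd_injective _ _ hu']
        · exact fun ht => ⟨u, rfl, hu, ht⟩
      have : s u = v ↔ s' u = v := by rw [← key s, ← key s', h]
      cases hs : s u <;> cases hs' : s' u <;> cases v <;> simp_all
  · rintro S ⟨h₁, h₂, h₃⟩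
    -- The inverse map gives the value `v` to the members of `S` and to the forced variables.
    refine ⟨fun u => if I.Forced ins u ∨ Fin.castAdd w u ∈ S then v else !v, ⟨?_, ?_⟩, ?_⟩
    · intro u hu
      simp [hu]
    · intro c hc C hC
      obtain ⟨j, hj, hf, hS⟩ := h₃ c hc C hC
      exact ⟨j, hj, by simp [hf, hS]⟩
    · ext x
      constructor
      · rintro ⟨u, rfl, hf, hu⟩
        by_contra hS
        simp [hf, hS] at hu
      · intro hx
        induction x using Fin.addCases with
        | left u => exact ⟨u, rfl, fun hf => h₂ u hf hx, by simp [hx]⟩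
        | right a => exact absurd hx (h₁ a)

omit hdef

/-- An empty hyper-edge could only come from a clause with all variables forced, which is a
conflict. -/
theorem nonempty_of_isEdge (hw : w ≠ 0) (hI : ¬ I.Conflict ins cls)
    {e : Set (Fin (I.numVars + w))} (he : I.IsEdge ins cls w e) : e.Nonempty := by
  rcases he with rfl | ⟨a, rfl⟩ | ⟨c, hc, j, hj, rfl⟩ | ⟨c, hc, C, hC, rfl⟩
  · exact ⟨_, ⟨0, Nat.pos_of_ne_zero hw⟩, rfl⟩
  · exact ⟨_, rfl⟩
  · exact ⟨_, rfl⟩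
  · by_contra h
    refine hI ⟨c, hc, C, hC, fun j hj => ?_⟩
    by_contra hf
    exact h ⟨_, j, hj, hf, rfl⟩

/-- The maximum is attained by the hyper-edge of all new vertices; identifying arguments or deleting
forced ones can only make the others smaller. -/
theorem isGreatest_width (hw : w ≠ 0) (hlen : ∀ i, ∀ C ∈ cls i, C.length ≤ w) :
    IsGreatest (Set.ncard '' {e | I.IsEdge ins cls w e}) w := by
  classical
  refine ⟨⟨_, .inl rfl, ?_⟩, ?_⟩
  · rw [← Set.image_univ, Set.ncard_image_of_injective _ (Fin.natAdd_injective _ _)]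
    simp
  · rintro _ ⟨e, rfl | ⟨a, rfl⟩ | ⟨c, hc, j, hj, rfl⟩ | ⟨c, hc, C, hC, rfl⟩, rfl⟩
    · rw [← Set.image_univ, Set.ncard_image_of_injective _ (Fin.natAdd_injective _ _)]
      simp
    · rw [Set.ncard_singleton]; omega
    · rw [Set.ncard_singleton]; omega
    · have : I.clauseEdge ins w c C ⊆ (C.toFinset.image fun j => Fin.castAdd w (c.2 j) : Finset _) := by
        rintro x ⟨j, hj, -, rfl⟩
        simpa using ⟨j, hj, rfl⟩
      refine (Set.ncard_le_ncard this (Finset.finite_toSet _)).trans ?_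
      rw [Set.ncard_coe_finset]
      exact (Finset.card_image_le.trans C.toFinset_card_le).trans (hlen _ C hC)

/-- A new vertex lies in at most two hyper-edges, whence `2 ≤ k * d`. A hyper-edge at a variable `u`
can be charged to a position of a constraint where `u` stands; there are at most `d` of these, and
each is charged at most `k` times. -/
theorem ncard_edges_le {k d : ℕ} (hkd : 2 ≤ k * d) (hd : I.degree ≤ d)
    (hk : ∀ i j, (ins i).count j + (cls i).countP (fun C => decide (j ∈ C)) ≤ k)
    (x : Fin (I.numVars + w)) : Set.ncard {e | I.IsEdge ins cls w e ∧ x ∈ e} ≤ k * d := by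
  classical
  induction x using Fin.addCases with
  | right a =>
    have : {e | I.IsEdge ins cls w e ∧ Fin.natAdd I.numVars a ∈ e} ⊆
        {Set.range (Fin.natAdd I.numVars), {Fin.natAdd I.numVars a}} := by
      have hne (u : Fin I.numVars) : Fin.natAdd I.numVars a ≠ Fin.castAdd w u := by
        intro h
        have := congrArg Fin.val h
        simp at this
        omega
      rintro e ⟨rfl | ⟨b, rfl⟩ | ⟨c, hc, j, hj, rfl⟩ | ⟨c, hc, C, hC, rfl⟩, hx⟩
      · simp
      · rw [Set.mem_singleton_iff.1 hx]; simp
      · exact absurd hx (hne _)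
      · obtain ⟨j, -, -, hx⟩ := hx
        exact absurd hx (hne _)
    exact ((Set.ncard_le_ncard this (Set.toFinite _)).trans (Set.ncard_insert_le _ _)).trans
      (by rw [Set.ncard_singleton]; exact hkd)
  | left u =>
    -- The hyper-edges that can be charged to the position `j` of `c`: a singleton if `j` is pinned
    -- to `v`, and one for each clause that contains `j`.
    let E (c : Constraint Γ (Fin I.numVars)) (j : Fin (Γ.get c.1).arity) :
        Finset (Set (Fin (I.numVars + w))) :=
      (if j ∈ ins c.1 then {{Fin.castAdd w (c.2 j)}} else ∅) ∪
        ((cls c.1).filter fun C => decide (j ∈ C)).toFinset.image (I.clauseEdge ins w c)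
    have hE (c j) : (E c j).card ≤ k := by
      refine (Finset.card_union_le _ _).trans ((Nat.add_le_add ?_ ?_).trans (hk c.1 j))
      · split_ifs with h
        · simpa using List.count_pos_iff.2 h
        · simp
      · refine (Finset.card_image_le.trans (List.toFinset_card_le _)).trans ?_
        rw [List.countP_eq_length_filter]
    have hsub : {e | I.IsEdge ins cls w e ∧ Fin.castAdd w u ∈ e} ⊆
        (I.constraints.biUnion fun c => (Finset.univ.filter fun j => c.2 j = u).biUnion (E c) :
          Finset _) := by
      rintro e ⟨rfl | ⟨b, rfl⟩ | ⟨c, hc, j, hj, rfl⟩ | ⟨c, hc, C, hC, rfl⟩, hx⟩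
      · obtain ⟨a, ha⟩ := hx
        have := congrArg Fin.val ha
        simp at this
        omega
      · have := congrArg Fin.val (Set.mem_singleton_iff.1 hx)
        simp at this
        omega
      · have hu := Fin.castAdd_injective _ _ (Set.mem_singleton_iff.1 hx)
        simp only [Finset.coe_biUnion, Set.mem_iUnion]
        refine ⟨c, hc, j, by simp [hu], ?_⟩
        simp [E, hj]
      · obtain ⟨j, hj, hf, hx⟩ := hx
        have hu := Fin.castAdd_injective _ _ hx
        simp only [Finset.coe_biUnion, Set.mem_iUnion]
        refine ⟨c, hc, j, by simp [hu], ?_⟩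
        refine Finset.mem_union_right _ (Finset.mem_image_of_mem _ ?_)
        simp [hC, hj]
    refine (Set.ncard_le_ncard hsub (Finset.finite_toSet _)).trans ?_
    rw [Set.ncard_coe_finset]
    calc _ ≤ ∑ c ∈ I.constraints, (Finset.univ.filter fun j => c.2 j = u).card * k :=
          Finset.card_biUnion_le.trans (Finset.sum_le_sum fun c _ =>
            Finset.card_biUnion_le_card_mul _ _ _ fun j _ => hE c j)
      _ = I.occurrences u * k := by rw [occurrences, Finset.sum_mul]
      _ ≤ k * d := by
        rw [Nat.mul_comm]
        exact Nat.mul_le_mul_left _ ((Finset.le_sup (Finset.mem_univ u)).trans hd)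

end CSPInstance

end BoundedCSP

end

/-! ### The written string is a code of the hypergraph -/

noncomputable section

namespace BoundedCSP

theorem card_filter_getD_eq_count_false {l : List Bool} {n : ℕ} (h : l.length = n) :
    (Finset.univ.filter fun u : Fin n => ¬ l.getD u false = true).card = l.count false := by
  subst h
  induction l with
  | nil => rfl
  | cons a l ih =>
    rw [Finset.card_filter] at ih ⊢
    refine (Fin.sum_univ_succ (n := l.length) _).trans ?_
    simp only [Fin.val_zero, List.getD_cons_zero, Fin.val_succ, List.getD_cons_succ]
    rw [ih, List.count_cons, add_comm]
    cases a <;> rfl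

theorem getD_foldl_set {α : Type} (l : List α) (f : α → ℕ) (b : List Bool) (u : ℕ) :
    (l.foldl (fun b j => b.set (f j) true) b).getD u false = true ↔
      b.getD u false = true ∨ (u < b.length ∧ ∃ j ∈ l, f j = u) := by
  induction l generalizing b with
  | nil => simp
  | cons x l ih =>
    rw [List.foldl_cons, ih]
    by_cases h : f x = u
    · subst h
      by_cases hx : f x < b.length <;> simp [hx]
    · simp [h]

theorem getD_marked {q m : ℕ} (T : Fin q → List (Fin m)) (L : List (RawConstraint q m))
    (b : List Bool) (u : ℕ) :
    (marked T L b).getD u false = true ↔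
      b.getD u false = true ∨ (u < b.length ∧ ∃ c ∈ L, ∃ j ∈ T c.1, c.2 j = u) := by
  induction L generalizing b with
  | nil => simp [marked]
  | cons c L ih =>
    rw [marked, List.foldl_cons]
    refine (ih _).trans ?_
    rw [getD_foldl_set, length_foldl_set]
    simp only [List.mem_cons, exists_eq_or_imp, and_or_left, or_assoc]

theorem outputValue_replicate (k : ℕ) :
    outputValue (List.replicate k false ++ [true]) = 2 ^ k := by
  induction k with
  | zero => rfl
  | succ k ih => simp [List.replicate_succ, outputValue, ih, pow_succ, Nat.mul_comm]

variable {Γ : ConstraintLanguage}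

/-- The greatest arity of a relation of `Γ`. -/
def maxArity (Γ : ConstraintLanguage) : ℕ := Finset.univ.sup fun i => (Γ.get i).arity

/-- All relations share the counters of the machine, of which there are as many as the greatest
arity. -/
def toPos (i : Fin Γ.length) : Fin (Γ.get i).arity → Fin (maxArity Γ) :=
  Fin.castLE (Finset.le_sup (f := fun i => (Γ.get i).arity) (Finset.mem_univ i))

theorem toPos_injective (i : Fin Γ.length) : Function.Injective (toPos i) :=
  Fin.castLE_injective _

/-- The scope of `c` as a function on all possible positions. -/
def toRaw {n : ℕ} (c : Constraint Γ (Fin n)) : RawConstraint Γ.length (maxArity Γ) :=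
  (c.1, fun j => if h : (j : ℕ) < (Γ.get c.1).arity then c.2 ⟨j, h⟩ else 0)

theorem toRaw_toPos {n : ℕ} (c : Constraint Γ (Fin n)) (j : Fin (Γ.get c.1).arity) :
    (toRaw c).2 (toPos c.1 j) = c.2 j := by
  have h : ((toPos c.1 j : Fin _) : ℕ) < (Γ.get c.1).arity := j.isLt
  simp only [toRaw]
  rw [dif_pos h]
  rfl

def positions (i : Fin Γ.length) : List (Fin (maxArity Γ)) := (List.finRange _).map (toPos i)

namespace CSPInstance

variable {I : CSPInstance Γ} {ins : ∀ i : Fin Γ.length, List (Fin (Γ.get i).arity)}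
  {cls : ∀ i : Fin Γ.length, List (List (Fin (Γ.get i).arity))}
  {L : List (Constraint Γ (Fin I.numVars))} (hL : ∀ c, c ∈ L ↔ c ∈ I.constraints)

include hL

theorem exists_raw_iff (u : Fin I.numVars) :
    (∃ c ∈ L.map toRaw, ∃ j ∈ (ins c.1).map (toPos c.1), c.2 j = u) ↔ I.Forced ins u := by
  constructor
  · rintro ⟨_, hr, k, hk, hu⟩
    obtain ⟨c, hc, rfl⟩ := List.mem_map.1 hr
    obtain ⟨j, hj, rfl⟩ := List.mem_map.1 hk
    refine ⟨c, (hL c).1 hc, j, hj, Fin.ext ?_⟩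
    rw [← hu]
    exact (toRaw_toPos c j).symm
  · rintro ⟨c, hc, j, hj, rfl⟩
    exact ⟨toRaw c, List.mem_map_of_mem ((hL c).2 hc), _, List.mem_map_of_mem hj, toRaw_toPos c j⟩

theorem getD_marked_iff (b : List Bool) (hb : b.length = I.numVars) (u : Fin I.numVars) :
    (marked (fun i => (ins i).map (toPos i)) (L.map toRaw) b).getD u false = true ↔
      b.getD u false = true ∨ I.Forced ins u := by
  rw [getD_marked, hb]
  rw [exists_raw_iff (ins := ins) hL u, and_iff_right u.isLt]

theorem conflict_iff {b : List Bool}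
    (hb : ∀ u : Fin I.numVars, b.getD u false = true ↔ I.Forced ins u) :
    conflict (fun i => (cls i).map (List.map (toPos i))) (L.map toRaw) b = true ↔
      I.Conflict ins cls := by
  rw [conflict, List.any_eq_true, Conflict]
  constructor
  · rintro ⟨_, hr, h⟩
    obtain ⟨c, hc, rfl⟩ := List.mem_map.1 hr
    obtain ⟨D, hD, h⟩ := List.any_eq_true.1 h
    obtain ⟨C, hC, rfl⟩ := List.mem_map.1 hD
    refine ⟨c, (hL c).1 hc, C, hC, fun j hj => (hb _).1 ?_⟩
    have := List.all_eq_true.1 h _ (List.mem_map_of_mem hj)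
    rwa [← toRaw_toPos]
  · rintro ⟨c, hc, C, hC, h⟩
    refine ⟨_, List.mem_map_of_mem ((hL c).2 hc), List.any_eq_true.2
      ⟨_, List.mem_map_of_mem hC, List.all_eq_true.2 fun k hk => ?_⟩⟩
    obtain ⟨j, hj, rfl⟩ := List.mem_map.1 hk
    exact (congrArg (fun x => b.getD x false) (toRaw_toPos c j)).trans ((hb _).2 (h j hj))

omit hL in
theorem setOf_mem_clause {w : ℕ} {b : List Bool}
    (hb : ∀ u : Fin I.numVars, b.getD u false = true ↔ I.Forced ins u)
    (c : Constraint Γ (Fin I.numVars)) (C : List (Fin (Γ.get c.1).arity)) :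
    {x : Fin (I.numVars + w) | (x : ℕ) ∈ ((C.map (toPos c.1)).filter fun j =>
      !b.getD ((toRaw c).2 j) false).reverse.map (toRaw c).2} = I.clauseEdge ins w c C := by
  ext x
  simp only [clauseEdge, Set.mem_ofPred_eq, List.mem_map, List.mem_reverse, List.mem_filter]
  constructor
  · rintro ⟨_, ⟨⟨j, hj, rfl⟩, hf⟩, hx⟩
    rw [toRaw_toPos] at hf hx
    refine ⟨j, hj, fun h => ?_, Fin.ext hx.symm⟩
    rw [(hb _).2 h] at hf
    cases hf
  · rintro ⟨j, hj, hf, rfl⟩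
    refine ⟨_, ⟨⟨j, hj, rfl⟩, ?_⟩, toRaw_toPos c j⟩
    rw [toRaw_toPos, Bool.not_eq_true', ← Bool.not_eq_true, hb]
    exact hf

/-- The hyper-edges that the reduction writes. -/
def rawEdges (ins : ∀ i : Fin Γ.length, List (Fin (Γ.get i).arity))
    (cls : ∀ i : Fin Γ.length, List (List (Fin (Γ.get i).arity))) (w : ℕ)
    (L : List (Constraint Γ (Fin I.numVars))) (b : List Bool) : List (List ℕ) :=
  freshEdges I.numVars w ++ (L.map toRaw).reverse.flatMap
    (newEdges (fun i => (ins i).map (toPos i)) (fun i => (cls i).map (List.map (toPos i))) b)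

omit hL in
theorem mem_rawEdges {w : ℕ} {b : List Bool} {l : List ℕ} :
    l ∈ rawEdges ins cls w L b ↔
      l = (List.range w).reverse.map (I.numVars + ·) ∨ (∃ a : Fin w, l = [I.numVars + (a : ℕ)]) ∨
      (∃ c ∈ L, ∃ j ∈ ins c.1, l = [(c.2 j : ℕ)]) ∨
      ∃ c ∈ L, ∃ C ∈ cls c.1, l = ((C.map (toPos c.1)).filter fun j =>
        !b.getD ((toRaw c).2 j) false).reverse.map (toRaw c).2 := by
  rw [rawEdges, freshEdges, List.mem_append, List.mem_cons, List.mem_flatMap, or_assoc]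
  refine or_congr Iff.rfl (or_congr ?_ ?_)
  · rw [List.mem_map]
    constructor
    · rintro ⟨a, ha, rfl⟩
      exact ⟨⟨a, by simpa using ha⟩, rfl⟩
    · rintro ⟨a, rfl⟩
      exact ⟨a, by simp, rfl⟩
  · constructor
    · rintro ⟨_, hr, hl⟩
      obtain ⟨c, hc, rfl⟩ := List.mem_map.1 (List.mem_reverse.1 hr)
      rcases List.mem_append.1 hl with hl | hl
      · obtain ⟨D, hD, rfl⟩ := List.mem_map.1 hl
        obtain ⟨C, hC, rfl⟩ := List.mem_map.1 (List.mem_reverse.1 hD)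
        exact .inr ⟨c, hc, C, hC, rfl⟩
      · obtain ⟨k, hk, rfl⟩ := List.mem_map.1 hl
        obtain ⟨j, hj, rfl⟩ := List.mem_map.1 (List.mem_reverse.1 hk)
        exact .inl ⟨c, hc, j, hj, congrArg (fun x => [x]) (toRaw_toPos c j)⟩
    · rintro (⟨c, hc, j, hj, rfl⟩ | ⟨c, hc, C, hC, rfl⟩)
      · refine ⟨toRaw c, List.mem_reverse.2 (List.mem_map_of_mem hc),
          List.mem_append_right _ (List.mem_map.2 ⟨toPos c.1 j,
            List.mem_reverse.2 (List.mem_map_of_mem hj), congrArg (fun x => [x])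
              (toRaw_toPos c j)⟩)⟩
      · exact ⟨toRaw c, List.mem_reverse.2 (List.mem_map_of_mem hc),
          List.mem_append_left _ (List.mem_map.2 ⟨_, List.mem_reverse.2
            (List.mem_map_of_mem hC), rfl⟩)⟩

/-- This links the hyper-edges, as sets of vertices, to the lists of numbers written by the program.
Such a list may contain repetitions, which codes allow. -/
theorem isEdge_iff {w : ℕ} {b : List Bool}
    (hb : ∀ u : Fin I.numVars, b.getD u false = true ↔ I.Forced ins u)
    (e : Set (Fin (I.numVars + w))) :
    I.IsEdge ins cls w e ↔ ∃ l ∈ rawEdges ins cls w L b, e = {x : Fin (I.numVars + w) | (x : ℕ) ∈ l} := by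
  have h₁ : {x : Fin (I.numVars + w) | (x : ℕ) ∈ (List.range w).reverse.map (I.numVars + ·)} =
      Set.range (Fin.natAdd I.numVars) := by
    ext x
    constructor
    · intro hx
      obtain ⟨a, ha, hx⟩ := List.mem_map.1 hx
      exact ⟨⟨a, by simpa using ha⟩, Fin.ext hx⟩
    · rintro ⟨a, rfl⟩
      exact List.mem_map.2 ⟨a, by simp, rfl⟩
  have h₂ (x : Fin (I.numVars + w)) (a : ℕ) (ha : (x : ℕ) = a) :
      {y : Fin (I.numVars + w) | (y : ℕ) ∈ [a]} = {x} := by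
    ext y
    subst ha
    simp [Fin.ext_iff]
  simp only [mem_rawEdges, IsEdge, ← hL]
  constructor
  · rintro (rfl | ⟨a, rfl⟩ | ⟨c, hc, j, hj, rfl⟩ | ⟨c, hc, C, hC, rfl⟩)
    · exact ⟨_, .inl rfl, h₁.symm⟩
    · exact ⟨_, .inr (.inl ⟨a, rfl⟩), (h₂ _ _ rfl).symm⟩
    · exact ⟨_, .inr (.inr (.inl ⟨c, hc, j, hj, rfl⟩)), (h₂ _ _ rfl).symm⟩
    · exact ⟨_, .inr (.inr (.inr ⟨c, hc, C, hC, rfl⟩)), (setOf_mem_clause hb c C).symm⟩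
  · rintro ⟨l, rfl | ⟨a, rfl⟩ | ⟨c, hc, j, hj, rfl⟩ | ⟨c, hc, C, hC, rfl⟩, rfl⟩
    · exact .inl h₁
    · exact .inr (.inl ⟨a, h₂ _ _ rfl⟩)
    · exact .inr (.inr (.inl ⟨c, hc, j, hj, h₂ (Fin.castAdd w (c.2 j)) _ rfl⟩))
    · exact .inr (.inr (.inr ⟨c, hc, C, hC, setOf_mem_clause hb c C⟩))

omit hL in
theorem lt_of_mem_rawEdges {w : ℕ} {b : List Bool} {l : List ℕ}
    (hl : l ∈ rawEdges ins cls w L b) {x : ℕ} (hx : x ∈ l) : x < I.numVars + w := by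
  rcases mem_rawEdges.1 hl with rfl | ⟨a, rfl⟩ | ⟨c, hc, j, hj, rfl⟩ | ⟨c, hc, C, hC, rfl⟩
  · obtain ⟨a, ha, rfl⟩ := List.mem_map.1 hx
    have : a < w := by simpa using ha
    omega
  · have := List.mem_singleton.1 hx
    omega
  · have := List.mem_singleton.1 hx
    omega
  · obtain ⟨k, hk, rfl⟩ := List.mem_map.1 hx
    obtain ⟨j, -, rfl⟩ := List.mem_map.1 (List.mem_filter.1 (List.mem_reverse.1 hk)).1
    rw [toRaw_toPos]
    omega

variable (I ins cls)

omit hL in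
/-- The hypergraph of an instance without a conflict. -/
def hypergraph {w : ℕ} (hw : w ≠ 0) (hI : ¬ I.Conflict ins cls) : FinHypergraph where
  numVertices := I.numVars + w
  graph := ⟨Set.univ, {e | I.IsEdge ins cls w e}, fun _ _ => Set.subset_univ _⟩
  vertexSet_eq := rfl
  edge_nonempty _ he := nonempty_of_isEdge hw hI he

variable {I ins cls}

theorem isCode_hypergraph {w : ℕ} (hw : w ≠ 0) (hI : ¬ I.Conflict ins cls) {b : List Bool}
    (hb : ∀ u : Fin I.numVars, b.getD u false = true ↔ I.Forced ins u) :
    (I.hypergraph ins cls hw hI).IsCode (encodeNats ((I.numVars + w) ::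
      (rawEdges ins cls w L b).flatMap fun l => l.length :: l)) := by
  -- All numbers written are less than `I.numVars + w`, so they can be read as vertices.
  obtain ⟨M, hM⟩ : ∃ M : List (List (Fin (I.numVars + w))),
      M.map (List.map Fin.val) = rawEdges ins cls w L b := by
    have h := fun l (hl : l ∈ rawEdges ins cls w L b) x (hx : x ∈ l) => lt_of_mem_rawEdges hl hx
    generalize rawEdges ins cls w L b = A at h
    lift A to List (List (Fin (I.numVars + w))) using h
    exact ⟨A, rfl⟩
  refine ⟨M, fun e => ?_, ?_⟩
  · refine (isEdge_iff hL hb e).trans ?_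
    rw [← hM]
    have h (l : List (Fin (I.numVars + w))) :
        {x : Fin (I.numVars + w) | (x : ℕ) ∈ l.map Fin.val} = {x | x ∈ l} := by
      ext x
      exact List.mem_map_of_injective Fin.val_injective
    constructor
    · rintro ⟨_, hl, rfl⟩
      obtain ⟨l, hl', rfl⟩ := List.mem_map.1 hl
      exact ⟨l, hl', h l⟩
    · rintro ⟨l, hl, rfl⟩
      exact ⟨_, List.mem_map_of_mem hl, (h l).symm⟩
  · rw [← hM, List.flatMap_map]
    refine congrArg (fun l => encodeNats (_ :: l)) (List.flatMap_congr fun l _ => ?_)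
    rw [List.length_map, List.map_id']
    exact congrArg (List.cons _) (List.map_eq_flatMap ..)

end CSPInstance

open CSPInstance in
/-- A language whose relations are defined by pins of one kind and by clauses of width at most `w`,
in which each position occurs at most `k` times. -/
theorem apReducible_of_clauses (v : Bool) (ins : ∀ i : Fin Γ.length, List (Fin (Γ.get i).arity))
    (cls : ∀ i : Fin Γ.length, List (List (Fin (Γ.get i).arity)))
    (hdef : ∀ i (a : Fin (Γ.get i).arity → Bool), a ∈ (Γ.get i).tuples ↔
      (∀ j ∈ ins i, a j = v) ∧ ∀ C ∈ cls i, ∃ j ∈ C, a j ≠ v)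
    (w k d : ℕ) (h₀ : w = 0 → ∀ i, ∀ C ∈ cls i, ∃ j, C = [j])
    (h₁ : w ≠ 0 → 2 ≤ k * d ∧ (∀ i, ∀ C ∈ cls i, C.length ≤ w) ∧
      ∀ i j, (ins i).count j + (cls i).countP (fun C => decide (j ∈ C)) ≤ k) :
    APReducible (countCSP d Γ) (countHIS w (k * d)) := by
  classical
  refine Prog.apReducible (Prog.reduction positions (fun i => (ins i).map (toPos i))
    (fun i => (cls i).map (List.map (toPos i))) w) (inp := .rev) (out := .out) (by simp) startCtl
    -- The oracle is asked exactly when a hypergraph has been written; otherwise the output stack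
    -- already holds the number.
    (fun v => !v.fail && decide (w ≠ 0)) _ _ ?_
  rintro s ⟨I, hd⟩ ⟨L, hL, rfl⟩
  have hcode : (L.flatMap fun c => (c.1 : ℕ) :: List.ofFn fun j => (c.2 j : ℕ)) =
      (L.map toRaw).flatMap fun c => (c.1 : ℕ) :: (positions c.1).map c.2 := by
    rw [List.flatMap_map]
    refine List.flatMap_congr fun c _ => congrArg (List.cons _) ?_
    rw [positions, List.map_map, List.ofFn_eq_map]
    exact List.map_congr_left fun j _ => (toRaw_toPos c j).symm
  rw [hcode]
  obtain ⟨hfail, hout⟩ := result_reduction (pos := positions)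
    (ins := fun i => (ins i).map (toPos i)) (cls := fun i => (cls i).map (List.map (toPos i)))
    (fun i => (List.nodup_finRange _).map (toPos_injective i))
    (fun i j hj => by
      obtain ⟨j, -, rfl⟩ := List.mem_map.1 hj
      exact List.mem_map_of_mem (List.mem_finRange j))
    (fun i C hC j hj => by
      obtain ⟨C, -, rfl⟩ := List.mem_map.1 hC
      obtain ⟨j, -, rfl⟩ := List.mem_map.1 hj
      exact List.mem_map_of_mem (List.mem_finRange j))
    w I.numVars (L.map toRaw)
    (fun r hr k hk => by
      obtain ⟨c, -, rfl⟩ := List.mem_map.1 hr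
      obtain ⟨j, -, rfl⟩ := List.mem_map.1 hk
      exact (toRaw_toPos c j).trans_lt (c.2 j).isLt)
    (fun r hr k hk => by
      obtain ⟨c, -, rfl⟩ := List.mem_map.1 hr
      refine dif_neg fun h => hk (List.mem_map.2 ⟨⟨k, h⟩, List.mem_finRange _, rfl⟩))
  set b₀ := marked (fun i => (ins i).map (toPos i)) (L.map toRaw)
    (List.replicate I.numVars false) with hb₀
  have hb₀n : b₀.length = I.numVars := by simp [hb₀, length_marked]
  have hb (u : Fin I.numVars) : b₀.getD u false = true ↔ I.Forced ins u := by
    rw [hb₀, getD_marked_iff hL _ (by simp)]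
    simp
  have hconf := conflict_iff (cls := cls) hL hb
  by_cases hI : I.Conflict ins cls
  · rw [hconf.2 hI] at hfail hout
    refine .inr ⟨by simp [hfail], ?_⟩
    rw [hout, if_pos rfl]
    exact (Z_eq_zero hdef hI).symm
  · rw [Bool.eq_false_iff.2 (hconf.not.2 hI)] at hfail hout
    rw [if_neg (by simp)] at hout
    by_cases hw : w = 0
    · rw [if_pos hw] at hout
      refine .inr ⟨by simp [hw], ?_⟩
      rw [hout, outputValue_replicate]
      refine Eq.trans ?_ (Z_eq_two_pow hdef hI (h₀ hw)).symm
      have hT : (fun i => ((cls i).map (List.map (toPos i))).flatten) =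
          fun i => ((cls i).flatten).map (toPos i) := by
        funext i
        rw [List.map_flatten]
      rw [hT]
      have hb₁ := getD_marked_iff (ins := fun i => (cls i).flatten) hL b₀ hb₀n
      have hb₁n := length_marked (fun i => ((cls i).flatten).map (toPos i)) (L.map toRaw) b₀
      rw [hb₀n] at hb₁n
      refine congrArg _ ((card_filter_getD_eq_count_false hb₁n).symm.trans
        (congrArg _ (Finset.filter_congr fun u _ => ?_)))
      rw [← hb, ← hb₁]
    · rw [if_neg hw] at hout
      obtain ⟨hkd, hlen, hk⟩ := h₁ hw
      refine .inl ⟨by simp [hfail, hw], ⟨I.hypergraph ins cls hw hI, ?_, ?_⟩, ?_, ?_⟩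
      · exact (isGreatest_width hw hlen).csSup_eq
      · exact Finset.sup_le fun x _ => ncard_edges_le hkd hd hk x
      · rw [hout]
        exact isCode_hypergraph hL hw hI hb
      · exact (Z_eq_ncard hdef hw).symm

end BoundedCSP

end

/-! ### Normalized formulas, and formulas as lists of clauses -/

noncomputable section

namespace BoundedCSP

/-- The value that is of no use to a clause. -/
def Connective.value : Connective → Bool
  | .or => false
  | .nand => true

/-- This allows OR and NAND to be treated at the same time. -/
theorem Connective.holds_iff {r : ℕ} (g : Connective) (a : Fin r → Bool) (C : Multiset (Fin r)) :
    g.Holds a C ↔ ∃ i ∈ C, a i ≠ g.value := by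
  cases g <;> simp [Connective.Holds, Connective.value]

namespace ConjFormula

variable {r : ℕ} {g : Connective} {R : Set (Fin r → Bool)}

variable (g R) in
/-- Every tuple of `R` satisfies the clause with the set `C` of arguments. -/
def Implies (C : Finset (Fin r)) : Prop := ∀ a ∈ R, ∃ i ∈ C, a i ≠ g.value

/-- A variable that is constant on `R` has either the useless value, and can be dropped from the
clause, or the other value, and then satisfies the clause alone. -/
theorem Implies.of_pin {C : Finset (Fin r)} (hC : Implies g R C) {x : Fin r} {c : Bool}
    (hx : ∀ a ∈ R, a x = c) : Implies g R {x} ∨ Implies g R (C.erase x) := by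
  by_cases hc : c = g.value
  · refine .inr fun a ha => ?_
    obtain ⟨i, hi, h⟩ := hC a ha
    refine ⟨i, Finset.mem_erase.2 ⟨?_, hi⟩, h⟩
    rintro rfl
    exact h ((hx a ha).trans hc)
  · exact .inl fun a ha => ⟨x, Finset.mem_singleton_self x, by rwa [hx a ha]⟩

open Classical in
variable (g R) in
/-- All the pins that `R` implies, and the minimal ones of the clauses that it implies. -/
def canonical : ConjFormula r where
  pins := Finset.univ.filter fun p => ∀ a ∈ R, a p.1 = p.2
  clauses := (Finset.univ.filter fun C => Minimal (Implies g R) C ∧ 2 ≤ C.card).image Finset.val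
  clause_ne_zero c hc h := by
    obtain ⟨C, hC, rfl⟩ := Finset.mem_image.1 hc
    have := (Finset.mem_filter.1 hC).2.2
    rw [Finset.card_def, h] at this
    simp at this

theorem mem_pins_canonical {p : Fin r × Bool} :
    p ∈ (canonical g R).pins ↔ ∀ a ∈ R, a p.1 = p.2 := by
  simp [canonical]

theorem mem_clauses_canonical {c : Multiset (Fin r)} :
    c ∈ (canonical g R).clauses ↔
      ∃ C : Finset (Fin r), Minimal (Implies g R) C ∧ 2 ≤ C.card ∧ C.val = c := by
  simp [canonical, and_assoc]

/-- By `Implies.of_pin`, a pinned variable in a minimal clause would yield a smaller implied clause,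
or show that the clause has only this argument. Minimal clauses are pairwise incomparable. -/
theorem isNormalized_canonical : (canonical g R).IsNormalized where
  pin_notMem p hp c hc hx := by
    obtain ⟨C, hC, h₂, rfl⟩ := mem_clauses_canonical.1 hc
    have hx : p.1 ∈ C := hx
    rcases hC.prop.of_pin (mem_pins_canonical.1 hp) with h | h
    · have := Finset.card_le_card (hC.le_of_le h (Finset.singleton_subset_iff.2 hx))
      rw [Finset.card_singleton] at this
      omega
    · exact Finset.notMem_erase _ _ (hC.le_of_le h (Finset.erase_subset _ _) hx)
  nodup c hc := by
    obtain ⟨C, -, -, rfl⟩ := mem_clauses_canonical.1 hc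
    exact C.nodup
  two_le_card c hc := by
    obtain ⟨C, -, h₂, rfl⟩ := mem_clauses_canonical.1 hc
    exact h₂
  not_subset c hc c' hc' hne h := by
    obtain ⟨C, hC, -, rfl⟩ := mem_clauses_canonical.1 hc
    obtain ⟨C', hC', -, rfl⟩ := mem_clauses_canonical.1 hc'
    have h : C ≤ C' := h
    exact hne (congrArg _ (h.antisymm (hC'.le_of_le hC.prop h)))

/-- Each clause of the given formula contains a minimal implied clause. If that one has at least two
arguments, it belongs to the canonical formula; otherwise it amounts to an implied pin. -/
theorem Defines.canonical {φ : ConjFormula r} (hφ : φ.Defines g R) :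
    (canonical g R).Defines g R := by
  intro a
  constructor
  · intro ha
    refine ⟨fun p hp => mem_pins_canonical.1 hp a ha, fun c hc => ?_⟩
    obtain ⟨C, hC, -, rfl⟩ := mem_clauses_canonical.1 hc
    exact (g.holds_iff a _).2 (hC.prop a ha)
  · rintro ⟨hpins, hcls⟩
    refine (hφ a).2 ⟨fun p hp => hpins p (mem_pins_canonical.2 fun b hb => ((hφ b).1 hb).1 p hp),
      fun c hc => (g.holds_iff a c).2 ?_⟩
    have himp : Implies g R c.toFinset := fun b hb => by
      simpa using (g.holds_iff b c).1 (((hφ b).1 hb).2 c hc)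
    obtain ⟨C, hle, hC⟩ := exists_minimal_le_of_wellFoundedLT (Implies g R) c.toFinset himp
    by_cases h₂ : 2 ≤ C.card
    · obtain ⟨i, hi, h⟩ := (g.holds_iff a _).1 (hcls _ (mem_clauses_canonical.2 ⟨C, hC, h₂, rfl⟩))
      exact ⟨i, Multiset.mem_toFinset.1 (hle hi), h⟩
    · obtain ⟨x, hx, hCx⟩ : ∃ x ∈ c, C ⊆ {x} := by
        rcases C.eq_empty_or_nonempty with rfl | ⟨x, hx⟩
        -- The empty clause is implied only if `R` is empty. Then every pin is implied, and any
        -- argument of `c` will do.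
        · obtain ⟨x, hx⟩ := Multiset.exists_mem_of_ne_zero (φ.clause_ne_zero c hc)
          exact ⟨x, hx, Finset.empty_subset _⟩
        · exact ⟨x, Multiset.mem_toFinset.1 (hle hx), fun y hy =>
            Finset.mem_singleton.2 (Finset.card_le_one.1 (by omega) y hy x hx)⟩
      have := hpins (x, !g.value) (mem_pins_canonical.2 fun b hb => by
        obtain ⟨i, hi, h⟩ := hC.prop b hb
        rw [← Finset.mem_singleton.1 (hCx hi)]
        exact Bool.eq_not.2 h)
      exact ⟨x, hx, Bool.eq_not.1 this⟩

/-- A formula may pin a variable to both values, and both pins count as occurrences. -/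
theorem card_filter_pins (φ : ConjFormula r) (j : Fin r) (v : Bool) :
    (φ.pins.filter fun p => p.1 = j).card =
      (if (j, v) ∈ φ.pins then 1 else 0) + if (j, !v) ∈ φ.pins then 1 else 0 := by
  have h : (φ.pins.filter fun p => p.1 = j) =
      (Finset.univ.filter fun b => (j, b) ∈ φ.pins).map (Function.Embedding.sectR j Bool) := by
    ext ⟨i, b⟩
    simp only [Finset.mem_filter, Finset.mem_map, Finset.mem_univ, true_and,
      Function.Embedding.sectR_apply, Prod.mk.injEq]
    constructor
    · rintro ⟨h, rfl⟩
      exact ⟨b, h, rfl, rfl⟩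
    · rintro ⟨b, h, rfl, rfl⟩
      exact ⟨h, rfl⟩
  rw [h, Finset.card_map, Finset.card_filter, Fintype.sum_bool]
  cases v
  · exact add_comm _ _
  · rfl

theorem countP_toList {α : Type*} (s : Finset α) (p : α → Prop) [DecidablePred p] :
    s.toList.countP (fun x => decide (p x)) = (s.filter p).card := by
  rw [← Multiset.coe_countP, Finset.coe_toList, Multiset.countP_eq_card_filter]
  rfl

/-- A formula as a list of variables pinned to the useless value and a list of
clauses. -/
theorem Defines.exists_lists {φ : ConjFormula r} (hφ : φ.Defines g R) :
    ∃ (ins : List (Fin r)) (cls : List (List (Fin r))),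
      (∀ a, a ∈ R ↔ (∀ j ∈ ins, a j = g.value) ∧ ∀ C ∈ cls, ∃ j ∈ C, a j ≠ g.value) ∧
      (∀ C ∈ cls, (∃ j, C = [j]) ∨ ∃ c ∈ φ.clauses, C.length = c.card) ∧
      ∀ j, ins.count j + cls.countP (fun C => decide (j ∈ C)) ≤ φ.occurrences j := by
  refine ⟨(Finset.univ.filter fun j => (j, g.value) ∈ φ.pins).toList,
    -- Pins to the other value become clauses with one argument. Each still accounts for one
    -- occurrence of its variable.
    (Finset.univ.filter fun j => (j, !g.value) ∈ φ.pins).toList.map (fun j => [j]) ++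
      φ.clauses.toList.map Multiset.toList, fun a => (hφ a).trans ?_, ?_, fun j => ?_⟩
  · constructor
    · rintro ⟨hp, hc⟩
      refine ⟨fun j hj => hp (j, g.value) (by simpa using hj), fun C hC => ?_⟩
      rcases List.mem_append.1 hC with hC | hC
      · obtain ⟨j, hj, rfl⟩ := List.mem_map.1 hC
        exact ⟨j, List.mem_singleton_self j,
          Bool.eq_not.1 (hp (j, !g.value) (by simpa using hj))⟩
      · obtain ⟨c, h, rfl⟩ := List.mem_map.1 hC
        simpa using (g.holds_iff a c).1 (hc c (Finset.mem_toList.1 h))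
    · rintro ⟨hi, hC⟩
      refine ⟨fun ⟨j, b⟩ hp => ?_, fun c hc => (g.holds_iff a c).2 ?_⟩
      · by_cases hb : b = g.value
        · subst hb
          exact hi j (by simpa using hp)
        · obtain rfl := Bool.eq_not.2 hb
          obtain ⟨i, h, hne⟩ := hC [j] (List.mem_append_left _
            (List.mem_map.2 ⟨j, by simpa using hp, rfl⟩))
          rw [← List.mem_singleton.1 h]
          exact Bool.eq_not.2 hne
      · simpa using hC c.toList (List.mem_append_right _
          (List.mem_map_of_mem (Finset.mem_toList.2 hc)))
  · intro C hC
    rcases List.mem_append.1 hC with hC | hC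
    · obtain ⟨j, -, rfl⟩ := List.mem_map.1 hC
      exact .inl ⟨j, rfl⟩
    · obtain ⟨c, hc, rfl⟩ := List.mem_map.1 hC
      exact .inr ⟨c, Finset.mem_toList.1 hc, Multiset.length_toList c⟩
  · have h₁ (b : Bool) : ((Finset.univ.filter fun i => (i, b) ∈ φ.pins).toList).count j =
        if (j, b) ∈ φ.pins then 1 else 0 := by
      simp only [(Finset.nodup_toList _).count, Finset.mem_toList, Finset.mem_filter,
        Finset.mem_univ, true_and]
    have h₂ (l : List (Fin r)) :
        l.countP ((fun C => decide (j ∈ C)) ∘ fun i => [i]) = l.count j := by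
      refine List.countP_congr fun i _ => ?_
      rw [Function.comp_apply, decide_eq_true_iff, beq_iff_eq, List.mem_singleton, eq_comm]
    have h₃ : φ.clauses.toList.countP ((fun C => decide (j ∈ C)) ∘ Multiset.toList) ≤
        ∑ c ∈ φ.clauses, c.count j := by
      have : ((fun C => decide (j ∈ C)) ∘ Multiset.toList) =
          fun c : Multiset (Fin r) => decide (j ∈ c) := by
        funext c
        simp
      rw [this, countP_toList, Finset.card_filter]
      refine Finset.sum_le_sum fun c _ => ?_
      split_ifs with h
      · exact Multiset.one_le_count_iff_mem.2 h
      · exact Nat.zero_le _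
    rw [List.countP_append, List.countP_map, List.countP_map, h₂, h₁, h₁, occurrences,
      card_filter_pins φ j g.value]
    omega

end ConjFormula

theorem exists_lists_of_mem_pinLanguage (v : Bool) {S : BoolRel} (hS : S ∈ pinLanguage) :
    ∃ (ins : List (Fin S.arity)) (cls : List (List (Fin S.arity))),
      (∀ a, a ∈ S.tuples ↔ (∀ j ∈ ins, a j = v) ∧ ∀ C ∈ cls, ∃ j ∈ C, a j ≠ v) ∧
      (∀ C ∈ cls, ∃ j, C = [j]) ∧
      ∀ j, ins.count j + cls.countP (fun C => decide (j ∈ C)) ≤ 1 := by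
  obtain ⟨c, rfl⟩ : ∃ c, S = ⟨1, {fun _ => c}⟩ := by
    rcases List.mem_cons.1 hS with rfl | hS
    · exact ⟨_, rfl⟩
    · exact ⟨_, List.mem_singleton.1 hS⟩
  have h (a : Fin 1 → Bool) : a ∈ ({fun _ => c} : Set (Fin 1 → Bool)) ↔ a 0 = c := by
    rw [Set.mem_singleton_iff, funext_iff, Fin.forall_fin_one]
  by_cases hc : c = v
  · subst hc
    refine ⟨[0], [], fun a => (h a).trans (by simp), by simp, fun j => ?_⟩
    exact List.count_le_length (l := [0])
  · refine ⟨[], [[0]], fun a => (h a).trans ?_, by simp, fun j => ?_⟩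
    · rw [Bool.eq_not.2 hc]
      simp [Bool.eq_not]
    · rw [List.count_nil, zero_add]
      exact List.countP_le_length (l := [[0]])

end BoundedCSP

end

/-! ### The proposition -/

open BoundedCSP in
theorem mainTheorem7 (g : Connective) (R : BoolRel) (hR : R.IsConj g) (d : ℕ) (hd : 2 ≤ d) :
    (∃ φ : ConjFormula R.arity, φ.IsNormalized ∧ φ.Defines g R.tuples) ∧
    ∀ φ : ConjFormula R.arity, φ.IsNormalized → φ.Defines g R.tuples →
      APReducible (countCSP d (R :: pinLanguage)) (countHIS φ.width (φ.maxOccurrences * d)) := by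
  obtain ⟨φ₀, h₀⟩ := hR
  refine ⟨⟨_, ConjFormula.isNormalized_canonical, h₀.canonical⟩, fun φ hn hφ => ?_⟩
  have hle {c} (hc : c ∈ φ.clauses) : c.card ≤ φ.width := Finset.le_sup hc
  -- If there is a clause, some variable occurs in `φ`. So `k ≥ 1`, which gives `2 ≤ k * d` and
  -- covers the one occurrence of the variable in `R_zero` and `R_one`.
  have hk : φ.width ≠ 0 → 1 ≤ φ.maxOccurrences := fun hw => by
    obtain ⟨c, hc⟩ : φ.clauses.Nonempty := by
      rw [Finset.nonempty_iff_ne_empty]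
      exact fun h => hw (by rw [ConjFormula.width, h]; rfl)
    obtain ⟨x, hx⟩ := Multiset.exists_mem_of_ne_zero (φ.clause_ne_zero c hc)
    calc 1 ≤ c.count x := Multiset.one_le_count_iff_mem.2 hx
      _ ≤ ∑ c ∈ φ.clauses, c.count x :=
        Finset.single_le_sum (f := fun c => Multiset.count x c) (fun _ _ => Nat.zero_le _) hc
      _ ≤ φ.occurrences x := Nat.le_add_left _ _
      _ ≤ φ.maxOccurrences := Finset.le_sup (Finset.mem_univ x)
  have key : ∀ S ∈ R :: pinLanguage, ∃ (ins : List (Fin S.arity)) (cls : List (List (Fin S.arity))),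
      (∀ a, a ∈ S.tuples ↔ (∀ j ∈ ins, a j = g.value) ∧ ∀ C ∈ cls, ∃ j ∈ C, a j ≠ g.value) ∧
      (φ.width = 0 → ∀ C ∈ cls, ∃ j, C = [j]) ∧
      (φ.width ≠ 0 → (∀ C ∈ cls, C.length ≤ φ.width) ∧
        ∀ j, ins.count j + cls.countP (fun C => decide (j ∈ C)) ≤ φ.maxOccurrences) := by
    intro S hS
    rcases List.mem_cons.1 hS with rfl | hS
    · obtain ⟨ins, cls, hdef, hlen, hcount⟩ := hφ.exists_lists
      refine ⟨ins, cls, hdef, fun hw C hC => ?_, fun hw => ⟨fun C hC => ?_, fun j =>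
        (hcount j).trans (Finset.le_sup (Finset.mem_univ j))⟩⟩
      -- Width 0 excludes clauses of `φ`, since these have at least two arguments; what remains are
      -- pins.
      · refine (hlen C hC).resolve_right ?_
        rintro ⟨c, hc, -⟩
        have := (hn.two_le_card c hc).trans (hle hc)
        omega
      · rcases hlen C hC with ⟨j, rfl⟩ | ⟨c, hc, h⟩
        · exact Nat.one_le_iff_ne_zero.2 hw
        · exact h.trans_le (hle hc)
    · obtain ⟨ins, cls, hdef, hlen, hcount⟩ := exists_lists_of_mem_pinLanguage g.value hS
      refine ⟨ins, cls, hdef, fun _ => hlen, fun hw => ⟨fun C hC => ?_, fun j =>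
        (hcount j).trans (hk hw)⟩⟩
      obtain ⟨j, rfl⟩ := hlen C hC
      exact Nat.one_le_iff_ne_zero.2 hw
  choose ins cls hdef hzero hpos using fun i => key _ (List.get_mem (R :: pinLanguage) i)
  refine apReducible_of_clauses g.value ins cls hdef _ _ _ (fun hw i => hzero i hw) fun hw =>
    ⟨hd.trans (Nat.le_mul_of_pos_left d (hk hw)), fun i => (hpos i hw).1, fun i => (hpos i hw).2⟩
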